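/- Let $N\ge 1$ and let $w_1=r_1/q_1,\dots,w_N=r_N/q_N$ be positive rational numbers with $r_i,q_i\in\mathbb Z_{>0}$, $\gcd(r_i,q_i)=1$. For a positive rational number $x$ let $\zeta_N(s,x\,|\,w_1,\dots,w_N)$ be the Barnes zeta function, i.e. the meromorphic continuation to $\mathbb C$, holomorphic outside $\{1,\dots,N\}$, of the series $\sum_{n_1,\dots,n_N\ge 0}(x+n_1w_1+\cdots+n_Nw_N)^{-s}$, which converges absolutely for $\operatorname{Re}(s)>N$. Such a continuation exists, and $\zeta_N^{(n)}$ is its $n$-th derivative in $s$. Put $$w:=\frac{\operatorname{lcm}(r_1,\dots,r_N)}{\gcd(q_1,\dots,q_N)},\qquad \ell_i:=\frac{w}{w_i}\quad(1\le i\le N).$$ Then $\ell_1,\dots,\ell_N$ are integers. For $\boldsymbol k=(k_1,\dots,k_N)$ with $0\le k_i\le \ell_i-1$ write $$y(\boldsymbol k):=w^{-1}(x+k_1w_1+\cdots+k_Nw_N)=Y(\boldsymbol k)+\frac{u(\boldsymbol k)}{v(\boldsymbol k)},$$ with any integers $Y(\boldsymbol k)\ge 0$ and $1\le u(\boldsymbol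 k)\le v(\boldsymbol k)$ ($u(\boldsymbol k)/v(\boldsymbol k)$ need not be in lowest terms). Let $C_N(t):=(t+N-1)(t+N-2)\cdots(t+1)$ (with $C_1=1$) and $C_{N,y}(t):=C_N(t-y)$. Let $\zeta(s,y)$ be the Hurwitz zeta function. For integers $1\le u\le v$ let $$H\Big(s,\frac uv\Big):=\sum_{k=1}^v\cos\Big(\frac{\pi s}2-\frac{2\pi ku}v\Big)\,\zeta\Big(s,\frac kv\Big)$$ (a function of $s$ depending on the pair $(u,v)$), extended to the removable singularity $s=1$. Let $\gamma_n(y)$ be the generalized Stieltjes constants, defined by $\zeta(s,y)=\frac1{s-1}+\sum_{n\ge 0}\frac{(-1)^n}{n!}\gamma_n(y)(s-1)^n$. Let $\gamma$ be Euler's constant, $\zeta(s)$ the Riemann zeta function and $\psi=\Gamma'/\Gamma$. Superscripts $(a)$ on $\Gamma$, $\psi$, $H$ and $\zeta(\cdot,y)$ denote derivatives in $s$, and $C^{(k)}_{N,y}$ denotes the derivative in $t$. Then for all integers $\ell,n\ge 0$, with $y,Y,u,v$ standing for $y(\boldsymbol k),Y(\boldsymbol k),u(\boldsymbol k),v(\boldsymbol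 k)$, $$\begin{aligned}\zeta_N^{(n)}(-\ell,x\,|\,w_1,\dots,w_N)=\frac1{(N-1)!}&\sum_{j=0}^n\binom nj(-\log w)^{n-j}w^{\ell}\sum_{k_1=0}^{\ell_1-1}\cdots\sum_{k_N=0}^{\ell_N-1}\sum_{k=0}^{N-1}\frac{C^{(k)}_{N,y}(0)}{k!}\\ \times\Big[&(-1)^j\,2\sum_{\substack{a+b+c=j\\ a,b,c\ge 0}}\frac{j!}{a!\,b!\,c!}\,\Gamma^{(a)}(\ell+k+1)\,(-\log(2\pi v))^b\,(2\pi v)^{-(\ell+k+1)}\,H^{(c)}\Big(\ell+k+1,\frac uv\Big)\\ &-\sum_{m=0}^{Y-1}\Big(-\log\Big(m+\frac uv\Big)\Big)^j\Big(m+\frac uv\Big)^{\ell+k}\Big].\end{aligned}$$ Here the values of $H^{(c)}$ and $\Gamma^{(a)}$ are as follows. (1) For all integers $1\le u\le v$, $H(s,u/v)$ is entire in $s$, and for $c\ge 0$, $m\ge 2$, $$H^{(c)}\Big(m,\frac uv\Big)=-\sum_{k=1}^v\sum_{i=0}^c\binom ci\Big(\frac\pi2\Big)^{c-i}\sin\Big(\frac{\pi(m+c-i-1)}2-\frac{2\pi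 ku}v\Big)\,\zeta^{(i)}\Big(m,\frac kv\Big),$$ where, for $1\le k\le v$, $$\zeta^{(i)}\Big(m,\frac kv\Big)=\sum_{h=0}^\infty\Big(-\log\Big(h+\frac kv\Big)\Big)^i\Big(h+\frac kv\Big)^{-m},$$ while for $c\ge 0$ $$H^{(c)}\Big(1,\frac uv\Big)=\varepsilon_{c,u,v}+\sum_{k=1}^v\sum_{i=0}^c(-1)^{i+1}\binom ci\Big(\frac\pi2\Big)^{c-i}\sin\Big(\frac{\pi(c-i)}2-\frac{2\pi ku}v\Big)\gamma_i\Big(\frac kv\Big),$$ where $\varepsilon_{c,u,v}=\frac{(-1)^{c/2+1}}{c+1}\left(\frac\pi2\right)^{c+1}v$ if $c$ is even and $u=v$, and $\varepsilon_{c,u,v}=0$ otherwise. (2) For all integers $a\ge 0$, $m\ge 1$, $$\Gamma^{(a)}(m)=(m-1)!\sum_{\substack{k_1,\dots,k_a\ge 0\\ k_1+2k_2+\cdots+ak_a=a}}\frac{a!}{k_1!\cdots k_a!}\Big(\frac{\psi(m)}{1!}\Big)^{k_1}\Big(\frac{\psi'(m)}{2!}\Big)^{k_2}\cdots\Big(\frac{\psi^{(a-1)}(m)}{a!}\Big)^{k_a},$$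 where $\psi(m)=-\gamma+\sum_{k=1}^{m-1}\frac1k$ and $\psi^{(b)}(m)=(-1)^{b+1}\,b!\,\Big(\zeta(b+1)-\sum_{k=1}^{m-1}\frac1{k^{b+1}}\Big)$ for $b\ge 1$. -/

import Mathlib

open Filter Topology
open scoped Nat

noncomputable section

/-- `Z` is the meromorphic continuation of the Barnes zeta function
`ζ_N(s, x | w₁, …, w_N) = ∑_{n₁, …, n_N ≥ 0} (x + n₁ w₁ + ⋯ + n_N w_N)^{-s}`: the series converges
absolutely to `Z s` for `Re s > N`, and `Z` is meromorphic on the whole plane and holomorphic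
outside `{1, …, N}`. By the identity theorem these conditions determine `Z` outside
`{1, …, N}`. -/
structure IsBarnesZeta (N : ℕ) (x : ℂ) (w : Fin N → ℂ) (Z : ℂ → ℂ) : Prop where
  hasSum : ∀ s : ℂ, (N : ℝ) < s.re →
    HasSum (fun n : Fin N → ℕ => 1 / (x + ∑ i, (n i : ℂ) * w i) ^ s) (Z s)
  meromorphic : ∀ s : ℂ, MeromorphicAt Z s
  holomorphic : DifferentiableOn ℂ Z {s : ℂ | ∃ k ∈ Finset.Icc 1 N, s = (k : ℂ)}ᶜ

/-- The Barnes zeta function `s ↦ ζ_N(s, x | w₁, …, w_N)`, continued meromorphically. -/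
def barnesZeta (N : ℕ) (x : ℂ) (w : Fin N → ℂ) : ℂ → ℂ :=
  Classical.epsilon (IsBarnesZeta N x w)

/-- The function `f` with its value at `p` replaced by `lim_{s → p, s ≠ p} f s`; when `p` is a
removable singularity of `f` this is the holomorphic extension of `f` across `p`. -/
def removeSingularity (f : ℂ → ℂ) (p : ℂ) : ℂ → ℂ :=
  Function.update f p (limUnder (𝓝[≠] p) f)

/-- The Hurwitz zeta function `ζ(s, y)` as a function of `s`. It is used here for `0 < y ≤ 1` only,
where Mathlib's function (periodic in `y`) is the classical one. -/
def hurwitz (y : ℝ) : ℂ → ℂ :=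
  HurwitzZeta.hurwitzZeta (y : UnitAddCircle)

/-- The generalized Stieltjes constant `γ_n(y)` for `0 < y ≤ 1`, defined by the Laurent expansion
`ζ(s, y) = 1 / (s - 1) + ∑_{n ≥ 0} (-1)^n / n! * γ_n(y) * (s - 1)^n`. -/
def stieltjes (n : ℕ) (y : ℝ) : ℂ :=
  (-1) ^ n * iteratedDeriv n (removeSingularity (fun s => hurwitz y s - 1 / (s - 1)) 1) 1

/-- The function `H(s, u/v) = ∑_{k=1}^v cos(π s / 2 - 2 π k u / v) ζ(s, k/v)`, extended to the
removable singularity `s = 1`. -/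
def hurwitzH (u v : ℕ) : ℂ → ℂ :=
  removeSingularity (fun s => ∑ k ∈ Finset.Icc 1 v,
    Complex.cos (Real.pi * s / 2 - 2 * Real.pi * k * u / v) * hurwitz ((k : ℝ) / v) s) 1

/-- The term `ε_{c,u/v}`. -/
def epsilonTerm (c u v : ℕ) : ℂ :=
  if Even c ∧ u = v then
    (-1) ^ (c / 2 + 1) / ((c : ℂ) + 1) * ((Real.pi : ℂ) / 2) ^ (c + 1) * v
  else 0

/-- The set `π(n)` of tuples `(k₁, …, k_n)` of non-negative integers with
`k₁ + 2 k₂ + ⋯ + n k_n = n`; the coordinate `k_{i+1}` is `k i`. -/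
def partitionTuples (n : ℕ) : Finset (Fin n → ℕ) :=
  (Fintype.piFinset fun _ => Finset.range (n + 1)).filter
    fun k => ∑ i : Fin n, ((i : ℕ) + 1) * k i = n

/-- The polynomial `C_N(t) = (t + N - 1)(t + N - 2) ⋯ (t + 1)`, with `C_1 = 1`. -/
def polyC (N : ℕ) : Polynomial ℂ :=
  ∏ i ∈ Finset.Icc 1 (N - 1), (Polynomial.X + Polynomial.C (i : ℂ))

/-- The number `C_{N,y}^{(k)}(0)`, where `C_{N,y}(t) = C_N(t - y)`. -/
def derivC (N k : ℕ) (y : ℂ) : ℂ :=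
  (Polynomial.derivative^[k] ((polyC N).comp (Polynomial.X - Polynomial.C y))).eval 0

/-- `w = lcm(r₁, …, r_N) / gcd(q₁, …, q_N)`. -/
def commonPeriod {N : ℕ} (r q : Fin N → ℕ) : ℚ :=
  ((Finset.univ.lcm r : ℕ) : ℚ) / ((Finset.univ.gcd q : ℕ) : ℚ)

/-- `ℓ_i = w / w_i` with `w_i = r_i / q_i`. For positive `r_i`, `q_i` in lowest terms the quotient
is an integer, so that nothing is rounded. -/
def periodRatio {N : ℕ} (r q : Fin N → ℕ) (i : Fin N) : ℕ :=
  ⌊commonPeriod r q / ((r i : ℚ) / (q i : ℚ))⌋₊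

/-- `y(k₁, …, k_N) = w⁻¹ (x + k₁ w₁ + ⋯ + k_N w_N)` with `w_i = r_i / q_i`. -/
def shiftedArg {N : ℕ} (r q : Fin N → ℕ) (x : ℚ) (k : Fin N → ℕ) : ℚ :=
  (commonPeriod r q)⁻¹ * (x + ∑ i, (k i : ℚ) * ((r i : ℚ) / (q i : ℚ)))

/-- The box of all `(k₁, …, k_N)` with `0 ≤ k_i ≤ ℓ_i - 1`. -/
def periodBox {N : ℕ} (r q : Fin N → ℕ) : Finset (Fin N → ℕ) :=
  Fintype.piFinset fun i => Finset.range (periodRatio r q i)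

end

/-! The integers ℓ_i satisfy ℓ_i w_i = w. Writing n_i = m_i ℓ_i + k_i splits the Barnes series over
residue vectors k into series in w (m_1 + ⋯ + m_N + y(k)), whose terms depend only on M = ∑ m_i.
Exactly C_N(M) / (N - 1)! vectors m have sum M, and expanding C_N(t - y) in powers of t = M + y
turns each class into a combination of ζ(s - k, y) with 0 ≤ k < N. The resulting function
`barnesContinuation` continues the series (`isBarnesZeta_barnesContinuation`), and the identity
theorem forces every continuation to agree with it off {1, …, N} (`IsBarnesZeta.eqOn`).

Its derivatives at -l are therefore given by Hurwitz derivatives at -(l + k). Splitting off the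
first Y terms leaves the argument u/v in (0, 1], where the functional equation reads ζ(1 - s, u/v) =
2 Γ(s) (2πv)^(-s) H(s, u/v) (`hurwitz_one_sub`); the Leibniz rule for three factors gives the triple
sum (`iteratedDeriv_hurwitz_neg`).

For H, the residues at s = 1 cancel because the cosines add up to a multiple of cos(π/2) = 0; the
polar parts still leave the term ε (`iteratedDeriv_hurwitzH_one`). For Γ, the equation Γ' = ψ Γ
yields complete Bell polynomials in the derivatives of ψ (`iteratedDeriv_eq_sum_tupleWeight`), and
these come from termwise differentiation of the series of ψ, which rests on the convexity of log Γ.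
-/

/-! ### Termwise differentiation of series -/

/-- Iterated derivatives preserve locally uniform convergence of holomorphic functions. -/
lemma TendstoLocallyUniformlyOn.iteratedDeriv_holomorphic {ι : Type*} {p : Filter ι} {U : Set ℂ}
    {F : ι → ℂ → ℂ} {f : ℂ → ℂ} (hU : IsOpen U) (h : TendstoLocallyUniformlyOn F f p U)
    (hF : ∀ n, DifferentiableOn ℂ (F n) U) (k : ℕ) :
    TendstoLocallyUniformlyOn (fun n => iteratedDeriv k (F n)) (iteratedDeriv k f) p U := by
  induction k with
  | zero => simpa using h
  | succ k ih =>
    have := ih.deriv (Eventually.of_forall fun n => by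
      have := ((hF n).analyticOnNhd hU).iterated_deriv k
      rw [← iteratedDeriv_eq_iterate] at this
      exact this.differentiableOn) hU
    simpa [Function.comp_def, iteratedDeriv_succ] using this

/-- Termwise differentiation of a series of holomorphic functions with a summable bound. -/
lemma hasSum_iteratedDeriv_of_summable_bound {ι : Type*} {f : ι → ℂ → ℂ} {u : ι → ℝ} {U : Set ℂ}
    (hU : IsOpen U) (hf : ∀ n, DifferentiableOn ℂ (f n) U) (hu : Summable u)
    (hfu : ∀ n, ∀ z ∈ U, ‖f n z‖ ≤ u n) (k : ℕ) {z : ℂ} (hz : z ∈ U) :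
    HasSum (fun n => iteratedDeriv k (f n) z) (iteratedDeriv k (fun w => ∑' n, f n w) z) := by
  have h := (tendstoUniformlyOn_tsum hu hfu).tendstoLocallyUniformlyOn.iteratedDeriv_holomorphic hU
    (fun t => DifferentiableOn.fun_sum fun n _ => hf n) k
  refine (h.tendsto_at hz).congr fun t => ?_
  exact iteratedDeriv_fun_sum fun n _ =>
    ((hf n).analyticOnNhd hU z hz).contDiffAt.of_le le_top

/-- The larger endpoint power depends on whether x ≥ 1 or x ≤ 1; adding both gives one bound valid
on the whole strip. -/
lemma norm_ofReal_cpow_neg_le {x c d : ℝ} (hx : 0 < x) {s : ℂ} (hc : c ≤ s.re) (hd : s.re ≤ d) :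
    ‖1 / (x : ℂ) ^ s‖ ≤ x ^ (-c) + x ^ (-d) := by
  rw [one_div, ← Complex.cpow_neg, Complex.norm_cpow_eq_rpow_re_of_pos hx, Complex.neg_re]
  rcases le_total 1 x with h | h
  · have := Real.rpow_le_rpow_of_exponent_le h (neg_le_neg hc)
    have := Real.rpow_nonneg hx.le (-d)
    linarith
  · have := Real.rpow_le_rpow_of_exponent_ge hx h (neg_le_neg hd)
    have := Real.rpow_nonneg hx.le (-c)
    linarith

lemma summable_nat_add_rpow_neg {y c : ℝ} (hy : 0 < y) (hc : 1 < c) :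
    Summable fun n : ℕ => ((n : ℝ) + y) ^ (-c) := by
  rw [← summable_nat_add_iff 1]
  refine Summable.of_nonneg_of_le (fun n => by positivity) (fun n => ?_)
    ((summable_nat_add_iff 1).2 (Real.summable_nat_rpow.2 (neg_lt_neg hc)))
  exact Real.rpow_le_rpow_of_nonpos (by positivity) (by linarith) (by linarith)

lemma iteratedDeriv_one_div_const_cpow {x : ℝ} (hx : 0 < x) (i : ℕ) (s : ℂ) :
    iteratedDeriv i (fun s : ℂ => 1 / (x : ℂ) ^ s) s = (-(Real.log x : ℂ)) ^ i * (x : ℂ) ^ (-s) := by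
  have hx' : (x : ℂ) ≠ 0 := by exact_mod_cast hx.ne'
  have : (fun s : ℂ => 1 / (x : ℂ) ^ s) = fun s => Complex.exp (-(Real.log x : ℂ) * s) := by
    ext s
    rw [one_div, ← Complex.cpow_neg, Complex.cpow_def_of_ne_zero hx', Complex.ofReal_log hx.le]
    ring_nf
  rw [this, iteratedDeriv_cexp_const_mul, Complex.cpow_def_of_ne_zero hx', Complex.ofReal_log hx.le]
  ring_nf

/-! ### The digamma function at positive integers -/

/-- Iterated form of `ψ(x + 1) = ψ(x) + 1 / x`. -/
lemma digamma_add_natCast {x : ℝ} (hx : 0 < x) (n : ℕ) :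
    Complex.digamma ((x : ℂ) + n) = Complex.digamma x + ∑ k ∈ Finset.range n, 1 / ((x : ℂ) + k) := by
  induction n with
  | zero => simp
  | succ n ih =>
    rw [Finset.sum_range_succ, ← add_assoc, ← ih, Nat.cast_succ, ← add_assoc,
      Complex.digamma_apply_add_one, one_div]
    intro m h
    have := congrArg Complex.re h
    simp at this
    have h1 : (0 : ℝ) ≤ m := m.cast_nonneg
    have h2 : (0 : ℝ) ≤ n := n.cast_nonneg
    linarith

lemma digamma_natCast {m : ℕ} (hm : 1 ≤ m) :
    Complex.digamma (m : ℂ) =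
      -(Real.eulerMascheroniConstant : ℂ) + ∑ k ∈ Finset.Icc 1 (m - 1), 1 / (k : ℂ) := by
  obtain ⟨m, rfl⟩ := Nat.exists_eq_add_of_le hm
  have := digamma_add_natCast one_pos m
  rw [Complex.ofReal_one, Complex.digamma_one] at this
  rw [Nat.cast_add, Nat.cast_one, this, Nat.add_sub_cancel_left]
  congr 1
  refine .trans ?_ (Finset.sum_Ico_add' (fun k : ℕ => 1 / (k : ℂ)) 0 m 1)
  rw [← Finset.range_eq_Ico]
  exact Finset.sum_congr rfl fun k _ => by push_cast; ring

/-- Moves ψ to the real axis, where the convexity of log Γ can be used. -/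
lemma digamma_ofReal {x : ℝ} (hx : 0 < x) :
    Complex.digamma (x : ℂ) = (deriv (Real.log ∘ Real.Gamma) x : ℝ) := by
  have hd : DifferentiableAt ℝ Real.Gamma x :=
    Real.differentiableAt_Gamma fun m => by
      have : (0 : ℝ) ≤ m := m.cast_nonneg
      linarith
  have hdC : DifferentiableAt ℂ Complex.Gamma (x : ℂ) :=
    Complex.differentiableAt_Gamma _ fun m h => by
      have := congrArg Complex.re h
      have h1 : (0 : ℝ) ≤ m := m.cast_nonneg
      simp at this
      linarith
  have h1 : deriv Complex.Gamma (x : ℂ) = (deriv Real.Gamma x : ℝ) := by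
    have := hdC.hasDerivAt.comp_ofReal
    rw [funext Complex.Gamma_ofReal] at this
    exact this.unique hd.hasDerivAt.ofReal_comp
  rw [Function.comp_def, deriv.log hd (Real.Gamma_pos_of_pos hx).ne', Complex.digamma_def,
    logDeriv_apply, h1, Complex.Gamma_ofReal]
  push_cast
  rfl

/-- By convexity the derivative f of log Γ is monotone, so both values lie between f(n) and f(n + M
+ 1) for an integer M ≥ x. These differ by M + 1 terms 1 / (n + k), each tending to 0. -/
lemma tendsto_deriv_log_Gamma_sub {x : ℝ} (hx : 0 < x) :
    Tendsto (fun n : ℕ => deriv (Real.log ∘ Real.Gamma) (x + n) -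
      deriv (Real.log ∘ Real.Gamma) (1 + n)) atTop (𝓝 0) := by
  set f := deriv (Real.log ∘ Real.Gamma) with hf
  have hmono : MonotoneOn f (Set.Ioi 0) := Real.convexOn_log_Gamma.monotoneOn_deriv fun y hy =>
    ((Real.differentiableAt_Gamma fun m => by
      have : (0 : ℝ) ≤ m := m.cast_nonneg
      have : 0 < y := hy
      linarith).log (Real.Gamma_pos_of_pos hy).ne')
  obtain ⟨M, hM⟩ := exists_nat_ge x
  have hstep : ∀ y : ℝ, 0 < y → ∀ n : ℕ, f (y + n) = f y + ∑ k ∈ Finset.range n, 1 / (y + k) := by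
    intro y hy n
    have := digamma_add_natCast hy n
    rw [digamma_ofReal hy, ← Complex.ofReal_natCast, ← Complex.ofReal_add,
      digamma_ofReal (by positivity)] at this
    exact_mod_cast this
  have hlim : Tendsto (fun n : ℕ => ∑ k ∈ Finset.range (M + 1), 1 / ((n : ℝ) + k)) atTop (𝓝 0) := by
    rw [← Finset.sum_const_zero (s := Finset.range (M + 1))]
    refine tendsto_finsetSum _ fun k _ => ?_
    have := tendsto_one_div_atTop_nhds_zero_nat (𝕜 := ℝ)
    have := this.comp (tendsto_add_atTop_nat k)
    simpa [Function.comp_def] using this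
  refine squeeze_zero_norm' ?_ hlim
  filter_upwards [eventually_gt_atTop 0] with n hn
  have hn' : (0 : ℝ) < n := by exact_mod_cast hn
  have hM0 : (0 : ℝ) ≤ M := M.cast_nonneg
  have key := hstep n hn' (M + 1)
  have a1 : f n ≤ f (x + n) := hmono hn' (show 0 < x + n by linarith) (by linarith)
  have a2 : f n ≤ f (1 + n) := hmono hn' (show (0 : ℝ) < 1 + n by linarith) (by linarith)
  have a3 : f (x + n) ≤ f (n + (M + 1 : ℕ)) :=
    hmono (show 0 < x + n by linarith) (show (0 : ℝ) < n + (M + 1 : ℕ) by positivity)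
      (by push_cast; linarith)
  have a4 : f (1 + n) ≤ f (n + (M + 1 : ℕ)) :=
    hmono (show (0 : ℝ) < 1 + n by linarith) (show (0 : ℝ) < n + (M + 1 : ℕ) by positivity)
      (by push_cast; linarith)
  rw [Real.norm_eq_abs, abs_le]
  constructor <;> linarith

/-- The difference is (s - 1) / ((n + 1)(s + n)). The condition Re s > 1/2 keeps |s + n| ≥ (n + 1) /
2, including at n = 0. -/
lemma norm_digamma_term_le {R : ℝ} {s : ℂ} (hs : 1 / 2 < s.re) (hR : ‖s‖ ≤ R) (n : ℕ) :
    ‖1 / ((n : ℂ) + 1) - 1 / (s + n)‖ ≤ 2 * (R + 1) * (1 / ((n : ℝ) + 1) ^ 2) := by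
  have hn : (0 : ℝ) ≤ n := n.cast_nonneg
  have h1 : ((n : ℂ) + 1) ≠ 0 := by exact_mod_cast n.succ_ne_zero
  have hre : (n : ℝ) + 1 / 2 ≤ ‖s + n‖ := by
    refine le_trans ?_ (Complex.re_le_norm _)
    simp
    linarith
  have h2 : s + n ≠ 0 := norm_pos_iff.1 (by linarith)
  have hn1 : ‖(n : ℂ) + 1‖ = n + 1 := by
    rw [← Nat.cast_succ, Complex.norm_natCast]; push_cast; rfl
  rw [div_sub_div _ _ h1 h2, norm_div, norm_mul, hn1]
  have h3 : ‖1 * (s + n) - ((n : ℂ) + 1) * 1‖ ≤ R + 1 := by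
    rw [show 1 * (s + n) - ((n : ℂ) + 1) * 1 = s - 1 by ring]
    refine (norm_sub_le _ _).trans ?_
    simpa using hR
  have hR0 : 0 ≤ R := (norm_nonneg s).trans hR
  calc _ ≤ (R + 1) / ((n + 1) * ((n + 1) / 2)) := by
        gcongr
        linarith
    _ = _ := by field_simp

lemma summable_digamma_bound (R : ℝ) :
    Summable fun n : ℕ => 2 * (R + 1) * (1 / ((n : ℝ) + 1) ^ 2) := by
  have := (summable_nat_add_iff 1).2 (Real.summable_one_div_nat_pow.2 one_lt_two)
  exact (by simpa using this : Summable fun n : ℕ => 1 / ((n : ℝ) + 1) ^ 2).mul_left _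

/-- Iterating the recurrence at x and at 1 shows that the n-th partial sum is ψ(x) + γ - (ψ(x + n) -
ψ(1 + n)), and the last difference tends to 0. -/
lemma digamma_ofReal_eq_tsum {x : ℝ} (hx : 1 / 2 < x) :
    Complex.digamma (x : ℂ) = -(Real.eulerMascheroniConstant : ℂ) +
      ∑' n : ℕ, (1 / ((n : ℂ) + 1) - 1 / ((x : ℂ) + n)) := by
  have hx0 : 0 < x := by linarith
  have hs : Summable fun n : ℕ => (1 / ((n : ℂ) + 1) - 1 / ((x : ℂ) + n)) :=
    Summable.of_norm_bounded (summable_digamma_bound ‖(x : ℂ)‖)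
      (norm_digamma_term_le (by simpa using hx) le_rfl)
  have h2 := hs.hasSum.tendsto_sum_nat
  have h3 := ((Complex.continuous_ofReal.tendsto _).comp (tendsto_deriv_log_Gamma_sub hx0))
  have h4 := (h2.add h3).const_add (-(Real.eulerMascheroniConstant : ℂ))
  simp only [Complex.ofReal_zero, add_zero] at h4
  refine tendsto_nhds_unique ?_ h4
  refine tendsto_const_nhds.congr fun n => ?_
  simp only [Function.comp_apply]
  have e1 := digamma_add_natCast hx0 n
  have e2 := digamma_add_natCast one_pos n
  rw [← Complex.ofReal_natCast, ← Complex.ofReal_add, digamma_ofReal (by positivity)] at e1 e2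
  rw [Complex.ofReal_one, Complex.digamma_one] at e2
  rw [Complex.ofReal_sub, e1, e2, Finset.sum_sub_distrib,
    Finset.sum_congr rfl fun k _ => by rw [add_comm ((k : ℂ)) 1]]
  ring

lemma iteratedDeriv_one_div_add {b : ℕ} (hb : 1 ≤ b) (c d s : ℂ) :
    iteratedDeriv b (fun s : ℂ => c - 1 / (s + d)) s =
      (-1) ^ (b + 1) * (b ! : ℂ) * (1 / (s + d) ^ (b + 1)) := by
  have : (fun s : ℂ => c - 1 / (s + d)) = fun s => c - (fun z : ℂ => z⁻¹) (s + d) := by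
    ext; simp
  rw [this, iteratedDeriv_const_sub hb, iteratedDeriv_neg]
  rw [congrFun (iteratedDeriv_comp_add_const b (fun z : ℂ => z⁻¹) d) s, iteratedDeriv_eq_iterate]
  have := iter_deriv_inv (𝕜 := ℂ) b (s + d)
  rw [show deriv^[b] (fun z : ℂ => z⁻¹) (s + d) = _ from this,
    show (-1 - (b : ℤ)) = -((b + 1 : ℕ) : ℤ) by push_cast; ring, zpow_neg, zpow_natCast]
  ring

lemma analyticAt_Gamma_of_re_pos {s : ℂ} (hs : 0 < s.re) : AnalyticAt ℂ Complex.Gamma s := by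
  rw [Complex.analyticAt_iff_eventually_differentiableAt]
  filter_upwards [(isOpen_lt continuous_const Complex.continuous_re).mem_nhds hs] with z hz
  refine Complex.differentiableAt_Gamma _ fun m h => ?_
  have := congrArg Complex.re h
  have h1 : (0 : ℝ) ≤ m := m.cast_nonneg
  simp at this
  have hz' : 0 < z.re := hz
  linarith

lemma analyticAt_digamma_of_re_pos {s : ℂ} (hs : 0 < s.re) : AnalyticAt ℂ Complex.digamma s :=
  (analyticAt_Gamma_of_re_pos hs).deriv.div (analyticAt_Gamma_of_re_pos hs)
    (Complex.Gamma_ne_zero_of_re_pos hs)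

/-- The identity theorem carries the series of ψ from the real axis to a complex neighbourhood of m.
Termwise differentiation then gives the tail ∑ 1 / (m + n)^(b+1) of ζ(b + 1). -/
lemma iteratedDeriv_digamma_natCast {b m : ℕ} (hb : 1 ≤ b) (hm : 1 ≤ m) :
    iteratedDeriv b Complex.digamma (m : ℂ) =
      (-1) ^ (b + 1) * (b ! : ℂ) *
        (riemannZeta ((b : ℂ) + 1) - ∑ k ∈ Finset.Icc 1 (m - 1), 1 / (k : ℂ) ^ (b + 1)) := by
  have hm' : (1 : ℝ) ≤ m := by exact_mod_cast hm
  set U : Set ℂ := {s | 1 / 2 < s.re} ∩ Metric.ball 0 (m + 1) with hUdef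
  have hU : IsOpen U := (isOpen_lt continuous_const Complex.continuous_re).inter Metric.isOpen_ball
  have hmU : (m : ℂ) ∈ U := ⟨by simp; linarith, by simp⟩
  set f : ℕ → ℂ → ℂ := fun n s => 1 / ((n : ℂ) + 1) - 1 / (s + n) with hfdef
  have hne : ∀ n : ℕ, ∀ s ∈ U, s + n ≠ 0 := fun n s hs h => by
    have := congrArg Complex.re h
    have h1 : (0 : ℝ) ≤ n := n.cast_nonneg
    have h2 : 1 / 2 < s.re := hs.1
    simp at this
    linarith
  have hf : ∀ n, DifferentiableOn ℂ (f n) U := fun n => by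
    refine DifferentiableOn.const_sub ?_ _
    exact (differentiableOn_const _).div (by fun_prop) (hne n)
  have hfu : ∀ n, ∀ z ∈ U, ‖f n z‖ ≤ 2 * ((m + 1 : ℝ) + 1) * (1 / ((n : ℝ) + 1) ^ 2) :=
    fun n z hz => norm_digamma_term_le hz.1 (mem_ball_zero_iff.1 hz.2).le n
  have hsum := hasSum_iteratedDeriv_of_summable_bound hU hf (summable_digamma_bound (m + 1 : ℝ)) hfu
  have hdiff : AnalyticAt ℂ (fun w => ∑' n, f n w) (m : ℂ) :=
    (Complex.differentiableOn_tsum_of_summable_norm (summable_digamma_bound (m + 1 : ℝ)) hf hU hfu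
      ).analyticAt (hU.mem_nhds hmU)
  have heq : Complex.digamma =ᶠ[𝓝 (m : ℂ)]
      fun s => -(Real.eulerMascheroniConstant : ℂ) + ∑' n, f n s := by
    refine ((analyticAt_digamma_of_re_pos (by simp; linarith)).frequently_eq_iff_eventually_eq
      (analyticAt_const.add hdiff)).1 ?_
    -- Real points accumulating at m, where the series is already known; this is what the identity
    -- theorem needs.
    have ht : Tendsto (fun j : ℕ => ((m + 1 / ((j : ℝ) + 1) : ℝ) : ℂ)) atTop (𝓝[≠] (m : ℂ)) := by
      refine tendsto_nhdsWithin_iff.2 ⟨?_, Eventually.of_forall fun j => ?_⟩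
      · have := (tendsto_one_div_add_atTop_nhds_zero_nat (𝕜 := ℝ)).const_add (m : ℝ)
        simpa [Function.comp_def] using (Complex.continuous_ofReal.tendsto _).comp this
      · intro h
        have h' : (m + 1 / ((j : ℝ) + 1) : ℝ) = m := Complex.ofReal_injective (by simpa using h)
        have : (0 : ℝ) < 1 / ((j : ℝ) + 1) := by positivity
        linarith
    refine ht.frequently (Frequently.of_forall fun j => digamma_ofReal_eq_tsum ?_)
    have : (0 : ℝ) < 1 / ((j : ℝ) + 1) := by positivity
    linarith
  rw [heq.iteratedDeriv_eq, iteratedDeriv_const_add hb, ← (hsum b hmU).tsum_eq]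
  simp only [hfdef, iteratedDeriv_one_div_add hb]
  rw [tsum_mul_left]
  congr 1
  have hz := zeta_nat_eq_tsum_of_gt_one (k := b + 1) (by omega)
  rw [Nat.cast_add, Nat.cast_one] at hz
  have hs : Summable fun n : ℕ => 1 / (n : ℂ) ^ (b + 1) := by
    have := (Real.summable_one_div_nat_pow (p := b + 1)).2 (by omega)
    exact (Complex.ofRealCLM.summable this).congr fun n => by simp
  rw [hz, ← hs.sum_add_tsum_nat_add m, eq_sub_iff_add_eq, add_comm]
  congr 1
  · obtain ⟨m, rfl⟩ := Nat.exists_eq_add_of_le hm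
    rw [add_comm 1 m, Finset.sum_range_succ', Nat.add_sub_cancel]
    -- The zeta series is indexed from 0; its term there is 1 / 0 = 0 by convention.
    rw [Nat.cast_zero, zero_pow (by omega), div_zero, add_zero, Finset.range_eq_Ico,
      Finset.sum_Ico_add' (fun k : ℕ => 1 / (k : ℂ) ^ (b + 1)) 0 m 1]
    rfl
  · exact tsum_congr fun n => by push_cast; ring

/-! ### Complete Bell polynomials and the derivatives of Γ -/

/-- Tuples `k : Fin M → ℕ` with `∑ (i + 1) k i = a`. -/
def weightedTuples (M a : ℕ) : Finset (Fin M → ℕ) :=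
  (Fintype.piFinset fun _ => Finset.range (a + 1)).filter
    fun k => ∑ i : Fin M, ((i : ℕ) + 1) * k i = a

/-- The box only provides finiteness: every weight is at least 1, so the weighted sum already forces
k_i ≤ a. -/
lemma mem_weightedTuples {M a : ℕ} {k : Fin M → ℕ} :
    k ∈ weightedTuples M a ↔ ∑ i : Fin M, ((i : ℕ) + 1) * k i = a := by
  rw [weightedTuples, Finset.mem_filter, and_iff_right_iff_imp]
  intro h
  rw [Fintype.mem_piFinset]
  intro i
  have := Finset.single_le_sum (f := fun i : Fin M => ((i : ℕ) + 1) * k i)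
    (fun _ _ => Nat.zero_le _) (Finset.mem_univ i)
  rw [Finset.mem_range]
  simp only [h] at this
  nlinarith [Nat.zero_le ((i : ℕ) * k i)]

/-- The weight `∏ x_i ^ k_i / k_i!` of a tuple. -/
noncomputable def tupleWeight {M : ℕ} (x : ℕ → ℂ) (k : Fin M → ℕ) : ℂ :=
  ∏ i : Fin M, x i ^ k i / ((k i)! : ℂ)

lemma tupleWeight_update_succ {M : ℕ} (x : ℕ → ℂ) (k : Fin M → ℕ) (i : Fin M) :
    ((k i + 1 : ℕ) : ℂ) * tupleWeight x (Function.update k i (k i + 1)) =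
      x i * tupleWeight x k := by
  have h : ∏ j ∈ Finset.univ.erase i, x j ^ Function.update k i (k i + 1) j /
      ((Function.update k i (k i + 1) j)! : ℂ) =
      ∏ j ∈ Finset.univ.erase i, x j ^ k j / ((k j)! : ℂ) :=
    Finset.prod_congr rfl fun j hj => by rw [Function.update_of_ne (Finset.ne_of_mem_erase hj)]
  rw [tupleWeight, tupleWeight, ← Finset.mul_prod_erase _ _ (Finset.mem_univ i),
    ← Finset.mul_prod_erase _ _ (Finset.mem_univ i), h, Function.update_self, Nat.factorial_succ]
  have h1 : ((k i)! : ℂ) ≠ 0 := by exact_mod_cast (k i).factorial_ne_zero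
  have h2 : ((k i + 1 : ℕ) : ℂ) ≠ 0 := by exact_mod_cast (k i).succ_ne_zero
  push_cast at h2 ⊢
  field_simp
  ring

lemma sum_update_weighted {M : ℕ} (k : Fin M → ℕ) (i : Fin M) (c : ℕ) :
    ∑ j : Fin M, ((j : ℕ) + 1) * Function.update k i c j + ((i : ℕ) + 1) * k i =
      ∑ j : Fin M, ((j : ℕ) + 1) * k j + ((i : ℕ) + 1) * c := by
  have h : ∑ j ∈ Finset.univ.erase i, ((j : ℕ) + 1) * Function.update k i c j =
      ∑ j ∈ Finset.univ.erase i, ((j : ℕ) + 1) * k j :=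
    Finset.sum_congr rfl fun j hj => by rw [Function.update_of_ne (Finset.ne_of_mem_erase hj)]
  rw [← Finset.add_sum_erase _ _ (Finset.mem_univ i),
    ← Finset.add_sum_erase _ (fun j : Fin M => ((j : ℕ) + 1) * k j) (Finset.mem_univ i), h,
    Function.update_self]
  ring

/-- Lowering k_i by one is a bijection from the tuples of weight a + 1 with k_i ≠ 0 onto those of
weight a - i. If i > a, one unit of k_i already exceeds the weight. -/
lemma sum_mul_tupleWeight {M : ℕ} (x : ℕ → ℂ) (a : ℕ) (i : Fin M) :
    ∑ k ∈ weightedTuples M (a + 1), (k i : ℂ) * tupleWeight x k =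
      if (i : ℕ) ≤ a then x i * ∑ k ∈ weightedTuples M (a - i), tupleWeight x k else 0 := by
  rw [← Finset.sum_filter_of_ne (p := fun k => k i ≠ 0)
    (fun k _ h => by rintro h0; simp [h0] at h)]
  split_ifs with hi
  · rw [Finset.mul_sum]
    refine Finset.sum_nbij' (fun k => Function.update k i (k i - 1))
      (fun k => Function.update k i (k i + 1)) ?_ ?_ ?_ ?_ ?_
    · intro k hk
      rw [Finset.mem_filter, mem_weightedTuples] at hk
      rw [mem_weightedTuples]
      have := sum_update_weighted k i (k i - 1)
      obtain ⟨c, hc⟩ := Nat.exists_eq_succ_of_ne_zero hk.2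
      rw [hk.1, hc] at this
      rw [hc]
      simp only [Nat.succ_eq_add_one, Nat.add_sub_cancel] at this ⊢
      rw [mul_add] at this
      omega
    · intro k hk
      rw [mem_weightedTuples] at hk
      rw [Finset.mem_filter, mem_weightedTuples, Function.update_self]
      refine ⟨?_, by omega⟩
      have := sum_update_weighted k i (k i + 1)
      rw [hk, mul_add] at this
      omega
    · intro k hk
      have h0 := (Finset.mem_filter.1 hk).2
      simp [Nat.sub_add_cancel (Nat.one_le_iff_ne_zero.2 h0)]
    · intro k _
      simp
    · intro k hk
      have h0 := (Finset.mem_filter.1 hk).2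
      have := tupleWeight_update_succ x (Function.update k i (k i - 1)) i
      simpa [Nat.sub_add_cancel (Nat.one_le_iff_ne_zero.2 h0)] using this
  · refine Finset.sum_eq_zero fun k hk => ?_
    rw [Finset.mem_filter, mem_weightedTuples] at hk
    have := Finset.single_le_sum (f := fun i : Fin M => ((i : ℕ) + 1) * k i)
      (fun _ _ => Nat.zero_le _) (Finset.mem_univ i)
    simp only [hk.1] at this
    have h1 : 1 ≤ k i := Nat.one_le_iff_ne_zero.2 hk.2
    nlinarith

/-- The sums are the coefficients of exp(∑ x_i t^(i+1)), and this is the recursion from its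
logarithmic derivative: replace a + 1 by ∑ (i + 1) k_i and lower each k_i. -/
lemma succ_mul_sum_tupleWeight {M a : ℕ} (h : a + 1 ≤ M) (x : ℕ → ℂ) :
    ((a : ℂ) + 1) * ∑ k ∈ weightedTuples M (a + 1), tupleWeight x k =
      ∑ i ∈ Finset.range (a + 1),
        ((i : ℂ) + 1) * x i * ∑ k ∈ weightedTuples M (a - i), tupleWeight x k := by
  have h1 : ((a : ℂ) + 1) * ∑ k ∈ weightedTuples M (a + 1), tupleWeight x k =
      ∑ i : Fin M, ((i : ℂ) + 1) * ∑ k ∈ weightedTuples M (a + 1), (k i : ℂ) * tupleWeight x k := by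
    simp only [Finset.mul_sum]
    rw [Finset.sum_comm]
    refine Finset.sum_congr rfl fun k hk => ?_
    rw [mem_weightedTuples] at hk
    have : ((a : ℂ) + 1) = ∑ i : Fin M, ((i : ℂ) + 1) * k i := by exact_mod_cast hk.symm
    rw [this, Finset.sum_mul]
    exact Finset.sum_congr rfl fun i _ => by ring
  rw [h1]
  simp only [sum_mul_tupleWeight]
  rw [Fin.sum_univ_eq_sum_range (fun i => ((i : ℂ) + 1) * (if i ≤ a then
    x i * ∑ k ∈ weightedTuples M (a - i), tupleWeight x k else 0)) M,
    ← Finset.sum_subset (Finset.range_mono h) (fun i _ hi => by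
      rw [Finset.mem_range, not_lt] at hi
      rw [if_neg (by omega), mul_zero])]
  refine Finset.sum_congr rfl fun i hi => ?_
  rw [if_pos (Nat.lt_succ_iff.1 (Finset.mem_range.1 hi)), mul_assoc]

/-- Solution of `f' = f g` in terms of the complete Bell polynomials. -/
lemma iteratedDeriv_eq_sum_tupleWeight {f g : ℂ → ℂ} {z : ℂ} (hf : AnalyticAt ℂ f z)
    (hg : AnalyticAt ℂ g z) (hfg : ∀ᶠ w in 𝓝 z, deriv f w = g w * f w) (a : ℕ) :
    ∀ M, a ≤ M → iteratedDeriv a f z = f z * (a ! : ℂ) * ∑ k ∈ weightedTuples M a,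
      tupleWeight (fun i => iteratedDeriv i g z / ((i + 1)! : ℂ)) k := by
  -- The tuple length M stays free, so that the hypothesis at a - i applies to tuples of the same
  -- length.
  induction a using Nat.strong_induction_on with
  | _ a ih =>
    intro M hM
    rcases a with _ | a
    · have h0 : weightedTuples M 0 = {0} := by
        ext k
        rw [mem_weightedTuples, Finset.mem_singleton, Finset.sum_eq_zero_iff]
        simp [funext_iff]
      simp [h0, tupleWeight]
    · set x : ℕ → ℂ := fun i => iteratedDeriv i g z / ((i + 1)! : ℂ) with hx
      rw [iteratedDeriv_succ', Filter.EventuallyEq.iteratedDeriv_eq a hfg,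
        iteratedDeriv_fun_mul (hg.contDiffAt.of_le le_top) (hf.contDiffAt.of_le le_top),
        Nat.factorial_succ]
      have := succ_mul_sum_tupleWeight hM x
      push_cast
      rw [show f z * (((a : ℂ) + 1) * (a ! : ℂ)) * ∑ k ∈ weightedTuples M (a + 1), tupleWeight x k =
        f z * (a ! : ℂ) * ((a + 1) * ∑ k ∈ weightedTuples M (a + 1), tupleWeight x k) by ring, this,
        Finset.mul_sum]
      refine Finset.sum_congr rfl fun i hi => ?_
      have hia : i ≤ a := Nat.lt_succ_iff.1 (Finset.mem_range.1 hi)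
      rw [ih (a - i) (by omega) M (by omega), Nat.cast_choose ℂ hia]
      have h1 : (i ! : ℂ) ≠ 0 := by exact_mod_cast i.factorial_ne_zero
      have h2 : ((a - i)! : ℂ) ≠ 0 := by exact_mod_cast (a - i).factorial_ne_zero
      have h3 : ((i : ℂ) + 1) ≠ 0 := by exact_mod_cast i.succ_ne_zero
      have h4 : ((i : ℂ) + 1) * x i = iteratedDeriv i g z / (i ! : ℂ) := by
        simp only [hx, Nat.factorial_succ]
        push_cast
        field_simp
      rw [h4]
      field_simp

lemma iteratedDeriv_Gamma_natCast (a : ℕ) {m : ℕ} (hm : 1 ≤ m) :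
    iteratedDeriv a Complex.Gamma (m : ℂ) =
      ((m - 1)! : ℂ) * ∑ k ∈ partitionTuples a,
        (a ! : ℂ) / (∏ i, ((k i)! : ℂ)) *
          ∏ i : Fin a,
            (iteratedDeriv (i : ℕ) Complex.digamma (m : ℂ) / (((i : ℕ) + 1)! : ℂ)) ^ (k i) := by
  have hre : 0 < (m : ℂ).re := by simpa using Nat.pos_of_ne_zero (by omega)
  have hG : Complex.Gamma (m : ℂ) = ((m - 1)! : ℂ) := by
    rw [← Complex.Gamma_nat_eq_factorial, Nat.cast_sub hm]
    simp
  rw [iteratedDeriv_eq_sum_tupleWeight (g := Complex.digamma) (analyticAt_Gamma_of_re_pos hre)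
    (analyticAt_digamma_of_re_pos hre) ?_ a a le_rfl, hG, mul_assoc, Finset.mul_sum]
  · congr 1
    refine Finset.sum_congr rfl fun k _ => ?_
    rw [tupleWeight, Finset.prod_div_distrib]
    ring
  · filter_upwards [(isOpen_lt continuous_const Complex.continuous_re).mem_nhds hre] with w hw
    rw [Complex.digamma_def, logDeriv_apply, div_mul_cancel₀ _ (Complex.Gamma_ne_zero_of_re_pos hw)]

/-! ### The function H and its derivatives at positive integers -/

lemma removeSingularity_of_ne (f : ℂ → ℂ) {p s : ℂ} (h : s ≠ p) : removeSingularity f p s = f s :=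
  Function.update_of_ne h _ _

lemma removeSingularity_eventuallyEq (f : ℂ → ℂ) {p s : ℂ} (h : s ≠ p) :
    removeSingularity f p =ᶠ[𝓝 s] f := by
  filter_upwards [isOpen_compl_singleton.mem_nhds h] with z hz using removeSingularity_of_ne f hz

/-- Riemann's theorem, asked only for (s - p) f(s) → 0. The arbitrary value f p does no harm, since
(s - p) f(p) → 0 as well. -/
lemma differentiable_removeSingularity {f : ℂ → ℂ} {p : ℂ}
    (hf : ∀ s, s ≠ p → DifferentiableAt ℂ f s)
    (h0 : Tendsto (fun s => (s - p) * f s) (𝓝[≠] p) (𝓝 0)) :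
    Differentiable ℂ (removeSingularity f p) := by
  rw [← differentiableOn_univ]
  refine Complex.differentiableOn_update_limUnder_of_isLittleO univ_mem
    (fun s hs => (hf s hs.2).differentiableWithinAt) ?_
  rw [Asymptotics.isLittleO_iff_tendsto']
  · have h1 : Tendsto (fun s : ℂ => (s - p) * f p) (𝓝[≠] p) (𝓝 0) := by
      have : ContinuousAt (fun s : ℂ => (s - p) * f p) p := by fun_prop
      simpa [ContinuousAt] using this.tendsto.mono_left nhdsWithin_le_nhds
    refine (by simpa using h0.sub h1 : Tendsto _ _ (𝓝 (0 : ℂ))).congr fun s => ?_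
    rw [div_inv_eq_mul]
    ring
  · filter_upwards [self_mem_nhdsWithin] with s hs h
    exact absurd (sub_eq_zero.1 (inv_eq_zero.1 h)) hs

lemma differentiableAt_hurwitz (y : ℝ) {s : ℂ} (hs : s ≠ 1) : DifferentiableAt ℂ (hurwitz y) s :=
  HurwitzZeta.differentiableAt_hurwitzZeta _ hs

lemma analyticAt_hurwitz (y : ℝ) {s : ℂ} (hs : s ≠ 1) : AnalyticAt ℂ (hurwitz y) s := by
  rw [Complex.analyticAt_iff_eventually_differentiableAt]
  filter_upwards [isOpen_compl_singleton.mem_nhds hs] with z hz using differentiableAt_hurwitz y hz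

/-- The function `ζ(s, y) - 1 / (s - 1)`, extended across `s = 1`. -/
noncomputable def hurwitzRegular (y : ℝ) : ℂ → ℂ :=
  removeSingularity (fun s => hurwitz y s - 1 / (s - 1)) 1

lemma differentiable_hurwitzRegular (y : ℝ) : Differentiable ℂ (hurwitzRegular y) := by
  refine differentiable_removeSingularity (fun s hs => ?_) ?_
  · refine (differentiableAt_hurwitz y hs).sub ?_
    exact (differentiableAt_const _).div (by fun_prop) (sub_ne_zero.2 hs)
  · have := (HurwitzZeta.hurwitzZeta_residue_one (y : UnitAddCircle)).sub_const 1
    rw [sub_self] at this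
    refine this.congr' ?_
    filter_upwards [self_mem_nhdsWithin] with s hs
    have : s - 1 ≠ 0 := sub_ne_zero.2 hs
    rw [hurwitz]
    field_simp

lemma hurwitz_eq_hurwitzRegular (y : ℝ) {s : ℂ} (hs : s ≠ 1) :
    hurwitz y s = hurwitzRegular y s + 1 / (s - 1) := by
  rw [hurwitzRegular, removeSingularity_of_ne _ hs, sub_add_cancel]

lemma iteratedDeriv_hurwitzRegular (y : ℝ) (n : ℕ) :
    iteratedDeriv n (hurwitzRegular y) 1 = (-1) ^ n * stieltjes n y := by
  rw [stieltjes, ← mul_assoc, ← mul_pow]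
  simp [hurwitzRegular]

lemma sum_exp_root {v : ℕ} {z : ℂ} (hz : z ^ v = 1) (h1 : z ≠ 1) :
    ∑ k ∈ Finset.Icc 1 v, z ^ k = 0 := by
  rw [← Finset.Ico_add_one_right_eq_Icc, Finset.sum_Ico_eq_sum_range]
  simp only [pow_add, pow_one, Nat.add_sub_cancel]
  rw [← Finset.mul_sum, geom_sum_eq h1, hz, sub_self, zero_div, mul_zero]

/-- In exponential form this is a geometric sum of powers of ω = exp(2πi u/v) and of its inverse.
Since 1 ≤ u ≤ v, the v-th root of unity ω is trivial exactly when u = v. -/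
lemma sum_cos_sub {u v : ℕ} (hu : 1 ≤ u) (huv : u ≤ v) (z : ℂ) :
    ∑ k ∈ Finset.Icc 1 v, Complex.cos (z - 2 * Real.pi * k * u / v) =
      if u = v then v * Complex.cos z else 0 := by
  have hv : (v : ℂ) ≠ 0 := by exact_mod_cast (by omega : v ≠ 0)
  split_ifs with h
  · subst h
    rw [Finset.sum_congr rfl (g := fun _ => Complex.cos z) fun k _ => ?_]
    · simp
    · rw [mul_div_cancel_right₀ _ hv, mul_comm (2 * (Real.pi : ℂ)), Complex.cos_sub_nat_mul_two_pi]
  · set ω : ℂ := Complex.exp (2 * Real.pi * Complex.I * (u / v)) with hω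
    have h1 : ω ^ v = 1 := by
      rw [hω, ← Complex.exp_nat_mul, Complex.exp_eq_one_iff]
      exact ⟨u, by field_simp; simp⟩
    have h2 : ω ≠ 1 := by
      rw [hω, Ne, Complex.exp_eq_one_iff]
      rintro ⟨n, hn⟩
      have hpi : (2 * Real.pi * Complex.I : ℂ) ≠ 0 := Complex.two_pi_I_ne_zero
      rw [mul_comm] at hn
      have hn' := mul_right_cancel₀ hpi hn
      rw [div_eq_iff hv] at hn'
      have hn2 : (u : ℤ) = n * v := by exact_mod_cast hn'
      have hlt : u < v := lt_of_le_of_ne huv h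
      rcases lt_or_ge n 1 with h3 | h3
      · have : n * (v : ℤ) ≤ 0 := mul_nonpos_of_nonpos_of_nonneg (by omega) (by omega)
        omega
      · have : (v : ℤ) ≤ n * v := le_mul_of_one_le_left (by omega) h3
        omega
    have h3 : ω⁻¹ ^ v = 1 := by rw [inv_pow, h1, inv_one]
    have h4 : ω⁻¹ ≠ 1 := by rwa [Ne, inv_eq_one]
    have key : ∀ k : ℕ, Complex.cos (z - 2 * Real.pi * k * u / v) =
        Complex.exp (z * Complex.I) / 2 * ω⁻¹ ^ k +
          Complex.exp (-z * Complex.I) / 2 * ω ^ k := by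
      intro k
      rw [Complex.cos, hω, ← Complex.exp_neg, ← Complex.exp_nat_mul, ← Complex.exp_nat_mul,
        div_mul_eq_mul_div, div_mul_eq_mul_div, ← Complex.exp_add, ← Complex.exp_add, add_div]
      congr 3 <;> ring
    simp only [key]
    rw [Finset.sum_add_distrib, ← Finset.mul_sum, ← Finset.mul_sum, sum_exp_root h1 h2,
      sum_exp_root h3 h4]
    simp

lemma iteratedDeriv_cos_mul_sub (θ : ℂ) (i : ℕ) :
    iteratedDeriv i (fun s : ℂ => Complex.cos (Real.pi * s / 2 - θ)) =
      fun s => ((Real.pi : ℂ) / 2) ^ i *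
        Complex.cos (Real.pi * s / 2 - θ + i * (Real.pi / 2)) := by
  induction i with
  | zero => simp
  | succ i ih =>
    ext s
    rw [iteratedDeriv_succ, ih]
    have h1 : HasDerivAt (fun s : ℂ => Real.pi * s / 2 - θ + i * (Real.pi / 2)) (Real.pi / 2) s := by
      have := ((((hasDerivAt_id s).const_mul (Real.pi : ℂ)).div_const 2).sub_const θ).add_const
        ((i : ℂ) * (Real.pi / 2))
      simpa using this
    rw [(h1.ccos.const_mul (((Real.pi : ℂ) / 2) ^ i)).deriv, Nat.cast_succ, add_mul, one_mul,
      ← add_assoc, Complex.cos_add_pi_div_two, pow_succ]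
    ring

/-- Each ζ(s, k/v) has residue 1 at s = 1, so the total residue is the cosine sum at angle π/2, a
multiple of cos(π/2) = 0. -/
lemma differentiable_hurwitzH {u v : ℕ} (hu : 1 ≤ u) (huv : u ≤ v) :
    Differentiable ℂ (hurwitzH u v) := by
  refine differentiable_removeSingularity (fun s hs => ?_) ?_
  · exact DifferentiableAt.fun_sum fun k _ => DifferentiableAt.mul (by fun_prop)
      (differentiableAt_hurwitz _ hs)
  · have h : Tendsto (fun s : ℂ => ∑ k ∈ Finset.Icc 1 v,
        Complex.cos (Real.pi * s / 2 - 2 * Real.pi * k * u / v) *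
          ((s - 1) * hurwitz ((k : ℝ) / v) s)) (𝓝[≠] 1)
        (𝓝 (∑ k ∈ Finset.Icc 1 v,
          Complex.cos (Real.pi * 1 / 2 - 2 * Real.pi * k * u / v) * 1)) := by
      refine tendsto_finsetSum _ fun k _ => Tendsto.mul ?_ (HurwitzZeta.hurwitzZeta_residue_one _)
      have : ContinuousAt (fun s : ℂ =>
        Complex.cos (Real.pi * s / 2 - 2 * Real.pi * k * u / v)) 1 := by fun_prop
      exact this.tendsto.mono_left nhdsWithin_le_nhds
    simp only [mul_one, sum_cos_sub hu huv, Complex.cos_pi_div_two, mul_zero, ite_self] at h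
    refine h.congr fun s => ?_
    rw [Finset.mul_sum]
    exact Finset.sum_congr rfl fun k _ => by ring

lemma iteratedDeriv_hurwitzH_of_two_le (u v c : ℕ) {m : ℕ} (hm : 2 ≤ m) :
    iteratedDeriv c (hurwitzH u v) (m : ℂ) =
      -∑ k ∈ Finset.Icc 1 v, ∑ i ∈ Finset.range (c + 1),
        (c.choose i : ℂ) * ((Real.pi : ℂ) / 2) ^ (c - i) *
          (Real.sin (Real.pi * ((m : ℝ) + c - i - 1) / 2 -
            2 * Real.pi * k * ((u : ℝ) / v)) : ℂ) *
          iteratedDeriv i (hurwitz ((k : ℝ) / v)) (m : ℂ) := by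
  have hm1 : (m : ℂ) ≠ 1 := by exact_mod_cast (by omega : m ≠ 1)
  have han : ∀ k : ℕ, ContDiffAt ℂ c (hurwitz ((k : ℝ) / v)) (m : ℂ) := fun k =>
    (analyticAt_hurwitz _ hm1).contDiffAt.of_le le_top
  have hcos : ∀ k : ℕ, ContDiffAt ℂ c
      (fun s : ℂ => Complex.cos (Real.pi * s / 2 - 2 * Real.pi * k * u / v)) (m : ℂ) := fun k => by
    have : Differentiable ℂ
      (fun s : ℂ => Complex.cos (Real.pi * s / 2 - 2 * Real.pi * k * u / v)) := by fun_prop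
    exact this.contDiff.contDiffAt
  rw [hurwitzH, (removeSingularity_eventuallyEq _ hm1).iteratedDeriv_eq,
    iteratedDeriv_fun_sum fun k _ => (hcos k).mul (han k), ← Finset.sum_neg_distrib]
  refine Finset.sum_congr rfl fun k _ => ?_
  -- The factors are swapped so that the Leibniz index i counts derivatives of ζ.
  simp only [mul_comm (Complex.cos _)]
  rw [iteratedDeriv_fun_mul (han k) (hcos k), ← Finset.sum_neg_distrib]
  refine Finset.sum_congr rfl fun i hi => ?_
  have hic : i ≤ c := Nat.lt_succ_iff.1 (Finset.mem_range.1 hi)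
  rw [iteratedDeriv_cos_mul_sub]
  have : Complex.cos (Real.pi * m / 2 - 2 * Real.pi * k * u / v + (c - i : ℕ) * (Real.pi / 2)) =
      -(Real.sin (Real.pi * ((m : ℝ) + c - i - 1) / 2 - 2 * Real.pi * k * ((u : ℝ) / v)) : ℂ) := by
    push_cast [hic]
    rw [← Complex.cos_add_pi_div_two]
    congr 1
    ring
  simp only [this]
  ring

/-- If `F(s) = (s - p) G(s)` near `p`, then `F^{(c+1)}(p) = (c + 1) G^{(c)}(p)`. -/
lemma iteratedDeriv_succ_sub_mul {F G : ℂ → ℂ} {p : ℂ} (hG : AnalyticAt ℂ G p)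
    (h : F =ᶠ[𝓝 p] fun s => (s - p) * G s) (c : ℕ) :
    iteratedDeriv (c + 1) F p = (c + 1) * iteratedDeriv c G p := by
  have hlin : AnalyticAt ℂ (fun s : ℂ => s - p) p := analyticAt_id.sub analyticAt_const
  rw [h.iteratedDeriv_eq, iteratedDeriv_fun_mul (hlin.contDiffAt.of_le le_top)
    (hG.contDiffAt.of_le le_top), Finset.sum_range_succ', Finset.sum_range_succ',
    Finset.sum_eq_zero]
  · have h1 : iteratedDeriv 1 (fun s : ℂ => s - p) p = 1 := by
      rw [iteratedDeriv_one]; simp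
    simp [h1]
  · intro i _
    have : iteratedDeriv (i + 1 + 1) (fun s : ℂ => s - p) = fun _ => 0 := by
      rw [iteratedDeriv_succ', iteratedDeriv_succ']
      have : deriv (fun s : ℂ => s - p) = fun _ => 1 := by ext; simp
      rw [this]
      ext s
      simp
    simp [this]

lemma cos_nat_mul_pi_div_two (c : ℕ) :
    Complex.cos (c * (Real.pi / 2)) = if Even c then (-1) ^ (c / 2) else 0 := by
  split_ifs with h
  · obtain ⟨j, rfl⟩ := h
    rw [← two_mul, Nat.mul_div_cancel_left _ two_pos]
    have h := congrArg (fun x : ℝ => (x : ℂ)) (Real.cos_nat_mul_pi j)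
    push_cast at h ⊢
    rw [← h]
    congr 1
    ring
  · obtain ⟨j, rfl⟩ := Nat.not_even_iff_odd.1 h
    rw [Complex.cos_eq_zero_iff]
    exact ⟨j, by push_cast; ring⟩

/-- Write ζ(s, k/v) as its regular part plus 1 / (s - 1). The regular parts give the Stieltjes sum
A. What remains is F(s) / (s - 1), with F(s) = v cos(πs/2) if u = v and F = 0 otherwise; its c-th
derivative at 1 is F^(c+1)(1) / (c + 1), which is ε. -/
lemma iteratedDeriv_hurwitzH_one {u v : ℕ} (hu : 1 ≤ u) (huv : u ≤ v) (c : ℕ) :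
    iteratedDeriv c (hurwitzH u v) 1 =
      epsilonTerm c u v +
        ∑ k ∈ Finset.Icc 1 v, ∑ i ∈ Finset.range (c + 1),
          (-1) ^ (i + 1) * (c.choose i : ℂ) * ((Real.pi : ℂ) / 2) ^ (c - i) *
            (Real.sin (Real.pi * ((c : ℝ) - i) / 2 -
              2 * Real.pi * k * ((u : ℝ) / v)) : ℂ) *
            stieltjes i ((k : ℝ) / v) := by
  have hcosD : ∀ k : ℕ, Differentiable ℂ
      (fun s : ℂ => Complex.cos (Real.pi * s / 2 - 2 * Real.pi * k * u / v)) := fun k => by fun_prop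
  set A : ℂ → ℂ := fun s => ∑ k ∈ Finset.Icc 1 v, hurwitzRegular ((k : ℝ) / v) s *
    Complex.cos (Real.pi * s / 2 - 2 * Real.pi * k * u / v) with hA
  have hAd : Differentiable ℂ A := Differentiable.fun_sum fun k _ =>
    (differentiable_hurwitzRegular _).mul (hcosD k)
  have hGd : Differentiable ℂ (fun s => hurwitzH u v s - A s) :=
    (differentiable_hurwitzH hu huv).sub hAd
  set F : ℂ → ℂ := fun s => (if u = v then (v : ℂ) else 0) * Complex.cos (Real.pi * s / 2 - 0) with hF
  have hmul : ∀ s, s ≠ 1 → F s = (s - 1) * (hurwitzH u v s - A s) := by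
    intro s hs
    have hs1 : s - 1 ≠ 0 := sub_ne_zero.2 hs
    have e1 : F s = ∑ k ∈ Finset.Icc 1 v,
        Complex.cos (Real.pi * s / 2 - 2 * Real.pi * k * u / v) := by
      rw [sum_cos_sub hu huv, hF]
      split_ifs <;> simp
    rw [e1, hurwitzH, removeSingularity_of_ne _ hs, hA, ← Finset.sum_sub_distrib, Finset.mul_sum]
    refine Finset.sum_congr rfl fun k _ => ?_
    rw [hurwitz_eq_hurwitzRegular _ hs]
    field_simp
    ring
  have hmul' : F =ᶠ[𝓝 1] fun s => (s - 1) * (hurwitzH u v s - A s) := by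
    refine Eventually.of_forall fun s => ?_
    -- Both sides are continuous and agree off 1, hence also at 1.
    have hFc : Continuous F := by fun_prop
    exact congrFun (Continuous.ext_on (dense_compl_singleton (1 : ℂ)) hFc
      ((continuous_id.sub continuous_const).mul hGd.continuous) hmul) s
  have hG := iteratedDeriv_succ_sub_mul (hGd.analyticAt 1) hmul' c
  have hc0 : (c : ℂ) + 1 ≠ 0 := by exact_mod_cast c.succ_ne_zero
  have hsplit : iteratedDeriv c (hurwitzH u v) 1 =
      iteratedDeriv c (fun s => hurwitzH u v s - A s) 1 + iteratedDeriv c A 1 := by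
    rw [← iteratedDeriv_fun_add hGd.contDiff.contDiffAt hAd.contDiff.contDiffAt]
    simp
  rw [hsplit]
  congr 1
  · have hFv : iteratedDeriv (c + 1) F 1 = (c + 1) * epsilonTerm c u v := by
      rw [hF, iteratedDeriv_const_mul_field, iteratedDeriv_cos_mul_sub, epsilonTerm]
      have : Complex.cos (Real.pi * 1 / 2 - 0 + (c + 1 : ℕ) * (Real.pi / 2)) =
          -Complex.cos (c * (Real.pi / 2)) := by
        rw [← Complex.cos_add_pi]
        congr 1
        push_cast
        ring
      simp only [this, cos_nat_mul_pi_div_two]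
      by_cases h1 : Even c <;> by_cases h2 : u = v
      · simp only [h1, h2, and_self, if_true]
        field_simp
        ring
      all_goals simp [h1, h2]
    rw [hFv] at hG
    exact (mul_left_cancel₀ hc0 hG).symm
  · rw [hA, iteratedDeriv_fun_sum fun k _ =>
      (differentiable_hurwitzRegular _).contDiff.contDiffAt.mul (hcosD k).contDiff.contDiffAt]
    refine Finset.sum_congr rfl fun k _ => ?_
    rw [iteratedDeriv_fun_mul (differentiable_hurwitzRegular _).contDiff.contDiffAt
      (hcosD k).contDiff.contDiffAt]
    refine Finset.sum_congr rfl fun i hi => ?_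
    have hic : i ≤ c := Nat.lt_succ_iff.1 (Finset.mem_range.1 hi)
    rw [iteratedDeriv_cos_mul_sub, iteratedDeriv_hurwitzRegular]
    have : Complex.cos (Real.pi * 1 / 2 - 2 * Real.pi * k * u / v + (c - i : ℕ) * (Real.pi / 2)) =
        -(Real.sin (Real.pi * ((c : ℝ) - i) / 2 - 2 * Real.pi * k * ((u : ℝ) / v)) : ℂ) := by
      push_cast [hic]
      rw [← Complex.cos_add_pi_div_two]
      congr 1
      ring
    simp only [this]
    ring

/-! ### Dirichlet series of the Hurwitz derivatives -/

lemma hasSum_hurwitz {y : ℝ} (hy : 0 < y) (hy1 : y ≤ 1) {s : ℂ} (hs : 1 < s.re) :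
    HasSum (fun n : ℕ => 1 / (((n : ℝ) + y : ℝ) : ℂ) ^ s) (hurwitz y s) := by
  simpa [hurwitz] using HurwitzZeta.hasSum_hurwitzZeta_of_one_lt_re (a := y) ⟨hy.le, hy1⟩ hs

lemma hasSum_iteratedDeriv_hurwitz {y : ℝ} (hy : 0 < y) (hy1 : y ≤ 1) (i : ℕ) {s : ℂ}
    (hs : 1 < s.re) :
    HasSum (fun h : ℕ => (-(Real.log ((h : ℝ) + y) : ℂ)) ^ i * (((h : ℝ) + y : ℝ) : ℂ) ^ (-s))
      (iteratedDeriv i (hurwitz y) s) := by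
  obtain ⟨c, hc1, hcs⟩ := exists_between hs
  have hpos : ∀ n : ℕ, 0 < (n : ℝ) + y := fun n => by positivity
  -- A half-plane would not do: for y < 1 the term n = 0 grows with Re z, so the strip is closed off
  -- on the right.
  set U : Set ℂ := {z | c < z.re} ∩ {z | z.re < s.re + 1}
  have hU : IsOpen U := (isOpen_lt continuous_const Complex.continuous_re).inter
    (isOpen_lt Complex.continuous_re continuous_const)
  have hsU : s ∈ U := ⟨hcs, by simp⟩
  have hd : ∀ n : ℕ, DifferentiableOn ℂ (fun s : ℂ => 1 / (((n : ℝ) + y : ℝ) : ℂ) ^ s) U :=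
    fun n => by
      have h0 : (((n : ℝ) + y : ℝ) : ℂ) ≠ 0 := by exact_mod_cast (hpos n).ne'
      refine (differentiableOn_const _).div ?_ fun z _ => ?_
      · exact (differentiable_id.const_cpow (Or.inl h0)).differentiableOn
      · exact fun h => h0 ((Complex.cpow_eq_zero_iff _ _).1 h).1
  have hsum : Summable fun n : ℕ => ((n : ℝ) + y) ^ (-c) + ((n : ℝ) + y) ^ (-(s.re + 1)) :=
    (summable_nat_add_rpow_neg hy hc1).add (summable_nat_add_rpow_neg hy (by linarith))
  have key := hasSum_iteratedDeriv_of_summable_bound hU hd hsum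
    (fun n z hz => norm_ofReal_cpow_neg_le (hpos n) (le_of_lt hz.1) (le_of_lt hz.2)) i hsU
  have heq : (fun w : ℂ => ∑' n : ℕ, 1 / (((n : ℝ) + y : ℝ) : ℂ) ^ w) =ᶠ[𝓝 s] hurwitz y := by
    filter_upwards [hU.mem_nhds hsU] with z hz
    exact (hasSum_hurwitz hy hy1 (hc1.trans hz.1)).tsum_eq
  rw [heq.iteratedDeriv_eq] at key
  refine key.congr_fun fun n => ?_
  exact (iteratedDeriv_one_div_const_cpow (hpos n) i s).symm

lemma hasSum_iteratedDeriv_hurwitz_natCast {y : ℝ} (hy : 0 < y) (hy1 : y ≤ 1) (i : ℕ) {m : ℕ}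
    (hm : 2 ≤ m) :
    HasSum (fun h : ℕ => (((-Real.log ((h : ℝ) + y)) ^ i * ((h : ℝ) + y) ^ (-(m : ℤ)) : ℝ) : ℂ))
      (iteratedDeriv i (hurwitz y) (m : ℂ)) := by
  have hm' : 1 < (m : ℂ).re := by
    rw [Complex.natCast_re]
    exact_mod_cast hm
  refine (hasSum_iteratedDeriv_hurwitz hy hy1 i hm').congr_fun fun h => ?_
  push_cast
  rw [Complex.cpow_neg, Complex.cpow_natCast, zpow_neg, zpow_natCast]

/-! ### The functional equation at rational arguments -/

lemma sum_zmod_eq_sum_Icc {v : ℕ} [NeZero v] (g : ZMod v → ℂ) :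
    ∑ j : ZMod v, g j = ∑ k ∈ Finset.Icc 1 v, g (k : ZMod v) := by
  have hinj : Set.InjOn (fun k : ℕ => (k : ZMod v)) (Finset.Icc 1 v : Finset ℕ) := by
    intro a ha b hb hab
    have ha' := Finset.mem_Icc.1 ha
    have hb' := Finset.mem_Icc.1 hb
    refine Nat.ModEq.eq_of_abs_lt ((ZMod.natCast_eq_natCast_iff a b v).1 hab) ?_
    rw [abs_lt]
    omega
  refine (Finset.sum_nbij (fun k : ℕ => (k : ZMod v)) (fun _ _ => Finset.mem_univ _) hinj ?_
    fun _ _ => rfl).symm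
  refine Finset.surjOn_of_injOn_of_card_le _ (fun _ _ => Finset.mem_coe.2 (Finset.mem_univ _)) hinj ?_
  rw [Finset.card_univ, ZMod.card, Nat.card_Icc]
  omega

/-- Hurwitz's formula involves the periodic zeta function at ±u/v. Sorting its series by residues
mod v gives Hurwitz values at k/v weighted by additive characters, and the two conjugate
exponentials combine into the cosine of H. -/
lemma hurwitz_one_sub {u v : ℕ} (hu : 1 ≤ u) (huv : u ≤ v) {s : ℂ} (hs : ∀ n : ℕ, s ≠ -n)
    (hs1 : s ≠ 1) :
    hurwitz ((u : ℝ) / v) (1 - s) =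
      2 * (Complex.Gamma s * (2 * Real.pi * v : ℂ) ^ (-s) * hurwitzH u v s) := by
  have : NeZero v := ⟨by omega⟩
  have hcirc : ∀ k : ℕ, (((k : ℝ) / v : ℝ) : UnitAddCircle) = ZMod.toAddCircle (k : ZMod v) := by
    intro k
    have := ZMod.toAddCircle_intCast (N := v) (k : ℤ)
    push_cast at this
    exact this.symm
  have hchar : ∀ m : ℤ, ZMod.stdAddChar (m : ZMod v) =
      Complex.exp (2 * Real.pi * Complex.I * m / v) := fun m => by
    rw [ZMod.stdAddChar_coe]
  have hexp : ∀ j : ZMod v, HurwitzZeta.expZeta (ZMod.toAddCircle j) s = (v : ℂ) ^ (-s) *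
      ∑ k ∈ Finset.Icc 1 v, ZMod.stdAddChar (j * (k : ZMod v)) * hurwitz ((k : ℝ) / v) s := by
    intro j
    rw [← ZMod.LFunction_stdAddChar_eq_expZeta j s (Or.inr hs1), ZMod.LFunction,
      sum_zmod_eq_sum_Icc]
    congr 1
    refine Finset.sum_congr rfl fun k _ => ?_
    rw [hurwitz, hcirc]
  have hpow : (2 * Real.pi * v : ℂ) ^ (-s) = (2 * Real.pi : ℂ) ^ (-s) * (v : ℂ) ^ (-s) := by
    have := Complex.mul_cpow_ofReal_nonneg (a := 2 * Real.pi) (b := v) (by positivity)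
      (by positivity) (-s)
    push_cast at this
    exact this
  rw [hurwitz, HurwitzZeta.hurwitzZeta_one_sub _ hs (Or.inr hs1), hcirc, ← map_neg, hexp, hexp, hpow,
    hurwitzH, removeSingularity_of_ne _ hs1]
  simp only [Finset.mul_sum]
  rw [← Finset.sum_add_distrib, Finset.mul_sum]
  refine Finset.sum_congr rfl fun k _ => ?_
  have e1 : ((u : ZMod v) * (k : ZMod v)) = (((u * k : ℕ) : ℤ) : ZMod v) := by push_cast; ring
  have e2 : (-(u : ZMod v) * (k : ZMod v)) = ((-(u * k : ℕ) : ℤ) : ZMod v) := by push_cast; ring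
  rw [e1, e2, hchar, hchar, Complex.cos]
  have e3 : Complex.exp (-Real.pi * Complex.I * s / 2) *
      Complex.exp (2 * Real.pi * Complex.I * ((u * k : ℕ) : ℤ) / v) =
      Complex.exp (-(Real.pi * s / 2 - 2 * Real.pi * k * u / v) * Complex.I) := by
    rw [← Complex.exp_add]
    congr 1
    push_cast
    ring
  have e4 : Complex.exp (Real.pi * Complex.I * s / 2) *
      Complex.exp (2 * Real.pi * Complex.I * (-(u * k : ℕ) : ℤ) / v) =
      Complex.exp ((Real.pi * s / 2 - 2 * Real.pi * k * u / v) * Complex.I) := by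
    rw [← Complex.exp_add]
    congr 1
    push_cast
    ring
  rw [← e3, ← e4]
  ring

lemma iteratedDeriv_mul_mul {f g h : ℂ → ℂ} {z : ℂ} (hf : AnalyticAt ℂ f z) (hg : AnalyticAt ℂ g z)
    (hh : AnalyticAt ℂ h z) (n : ℕ) :
    iteratedDeriv n (fun s => f s * g s * h s) z =
      ∑ t ∈ Finset.Nat.antidiagonalTuple 3 n, (n ! : ℂ) / ((t 0)! * (t 1)! * (t 2)!) *
        iteratedDeriv (t 0) f z * iteratedDeriv (t 1) g z * iteratedDeriv (t 2) h z := by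
  have leib : ∀ {f g : ℂ → ℂ}, AnalyticAt ℂ f z → AnalyticAt ℂ g z → ∀ n : ℕ,
      iteratedDeriv n (fun s => f s * g s) z = ∑ p ∈ Finset.HasAntidiagonal.antidiagonal n,
        (n ! : ℂ) / (p.1 ! * p.2 !) * iteratedDeriv p.1 f z * iteratedDeriv p.2 g z := by
    intro f g hf hg n
    rw [iteratedDeriv_fun_mul (hf.contDiffAt.of_le le_top) (hg.contDiffAt.of_le le_top),
      Finset.Nat.sum_antidiagonal_eq_sum_range_succ_mk]
    refine Finset.sum_congr rfl fun i hi => ?_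
    rw [Nat.cast_choose ℂ (Nat.lt_succ_iff.1 (Finset.mem_range.1 hi))]
  have e : (fun s => f s * g s * h s) = fun s => f s * (g s * h s) := by
    ext s
    ring
  rw [e, leib hf (g := fun s => g s * h s) (hg.mul hh)]
  simp only [leib hg hh, Finset.mul_sum]
  rw [Finset.sum_sigma']
  -- The nested antidiagonals (a, b), (c, d) with c + d = b flatten to triples (a, c, d); the factor
  -- b! cancels between the two binomials.
  refine Finset.sum_nbij' (fun x => ![x.1.1, x.2.1, x.2.2])
    (fun t => ⟨(t 0, t 1 + t 2), (t 1, t 2)⟩) ?_ ?_ ?_ ?_ ?_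
  · rintro ⟨⟨a, b⟩, ⟨c, d⟩⟩ hx
    simp only [Finset.mem_sigma, Finset.HasAntidiagonal.mem_antidiagonal] at hx
    rw [Finset.Nat.mem_antidiagonalTuple, Fin.sum_univ_three]
    simp
    omega
  · intro t ht
    rw [Finset.Nat.mem_antidiagonalTuple, Fin.sum_univ_three] at ht
    simp only [Finset.mem_sigma, Finset.HasAntidiagonal.mem_antidiagonal, and_true]
    omega
  · rintro ⟨⟨a, b⟩, ⟨c, d⟩⟩ hx
    simp only [Finset.mem_sigma, Finset.HasAntidiagonal.mem_antidiagonal] at hx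
    obtain ⟨_, rfl⟩ := hx
    rfl
  · intro t _
    ext i
    fin_cases i <;> rfl
  · rintro ⟨⟨a, b⟩, ⟨c, d⟩⟩ hx
    have hb : (b ! : ℂ) ≠ 0 := by exact_mod_cast b.factorial_ne_zero
    simp only [Matrix.cons_val_zero, Matrix.cons_val_one, Matrix.cons_val]
    field_simp

lemma iteratedDeriv_const_cpow_neg {x : ℝ} (hx : 0 < x) (i : ℕ) (s : ℂ) :
    iteratedDeriv i (fun s : ℂ => (x : ℂ) ^ (-s)) s =
      (-(Real.log x : ℂ)) ^ i * (x : ℂ) ^ (-s) := by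
  rw [← iteratedDeriv_one_div_const_cpow hx]
  simp [Complex.cpow_neg]

lemma analyticAt_const_cpow_neg {x : ℝ} (hx : 0 < x) (s : ℂ) :
    AnalyticAt ℂ (fun s : ℂ => (x : ℂ) ^ (-s)) s := by
  have hx' : (x : ℂ) ≠ 0 := by exact_mod_cast hx.ne'
  exact (differentiable_id.neg.const_cpow (Or.inl hx')).analyticAt s

/-- The derivatives of the Hurwitz zeta function at non-positive integers. -/
lemma iteratedDeriv_hurwitz_neg {u v : ℕ} (hu : 1 ≤ u) (huv : u ≤ v) (j p : ℕ) :
    iteratedDeriv j (hurwitz ((u : ℝ) / v)) (-(p : ℂ)) =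
      (-1) ^ j * 2 * ∑ t ∈ Finset.Nat.antidiagonalTuple 3 j,
        (j ! : ℂ) / ((t 0)! * (t 1)! * (t 2)!) *
          iteratedDeriv (t 0) Complex.Gamma ((p : ℂ) + 1) *
          (-(Real.log (2 * Real.pi * v) : ℂ)) ^ (t 1) *
          (2 * Real.pi * v : ℂ) ^ (-((p : ℤ) + 1)) *
          iteratedDeriv (t 2) (hurwitzH u v) ((p : ℂ) + 1) := by
  have hv : (0 : ℝ) < v := by exact_mod_cast (by omega : 0 < v)
  have hx : (0 : ℝ) < 2 * Real.pi * v := by positivity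
  have hxc : ((2 * Real.pi * v : ℝ) : ℂ) = 2 * Real.pi * v := by push_cast; rfl
  set M : ℂ := (p : ℂ) + 1 with hM
  have hMre : 0 < M.re := by
    simp [hM]
    positivity
  have hM1 : 1 - M ≠ 1 := fun h => by
    have : M = 0 := by linear_combination -h
    rw [this] at hMre
    simp at hMre
  have hMp : 1 - M = -(p : ℂ) := by rw [hM]; ring
  have hΓ := analyticAt_Gamma_of_re_pos hMre
  have hP := analyticAt_const_cpow_neg hx M
  have hH := (differentiable_hurwitzH hu huv).analyticAt M
  have hlhs : AnalyticAt ℂ (fun s => hurwitz ((u : ℝ) / v) (1 - s)) M :=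
    AnalyticAt.fun_comp (analyticAt_hurwitz _ hM1) (analyticAt_const.sub analyticAt_id)
  have heq : (fun s => hurwitz ((u : ℝ) / v) (1 - s)) =ᶠ[𝓝 M] fun s =>
      2 * (Complex.Gamma s * ((2 * Real.pi * v : ℝ) : ℂ) ^ (-s) * hurwitzH u v s) := by
    refine (hlhs.frequently_eq_iff_eventually_eq (analyticAt_const.mul ((hΓ.mul hP).mul hH))).1
      (Eventually.frequently ?_)
    -- For p = 0 the point M is 1 itself, where the functional equation is not yet available. It
    -- holds on a punctured neighbourhood, and analyticity of both sides fills the gap.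
    have h1 : ∀ᶠ s : ℂ in 𝓝[≠] M, s ≠ 1 := by
      rcases eq_or_ne M 1 with h | h
      · rw [h]
        exact self_mem_nhdsWithin
      · exact nhdsWithin_le_nhds (isOpen_compl_singleton.mem_nhds h)
    have h2 : ∀ᶠ s : ℂ in 𝓝[≠] M, 0 < s.re :=
      nhdsWithin_le_nhds ((isOpen_lt continuous_const Complex.continuous_re).mem_nhds hMre)
    filter_upwards [h1, h2] with s hs1 hs2
    have hs3 : ∀ n : ℕ, s ≠ -n := fun n h => by
      rw [h] at hs2
      simp at hs2
      have : (0 : ℝ) ≤ n := n.cast_nonneg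
      linarith
    rw [hurwitz_one_sub hu huv hs3 hs1, hxc]
    rfl
  have hd := heq.iteratedDeriv_eq j
  rw [iteratedDeriv_comp_const_sub, iteratedDeriv_const_mul_field,
    iteratedDeriv_mul_mul hΓ hP hH] at hd
  simp only [iteratedDeriv_const_cpow_neg hx, hMp] at hd
  rw [hxc] at hd
  have hz : (2 * Real.pi * v : ℂ) ^ (-M) = (2 * Real.pi * v : ℂ) ^ (-((p : ℤ) + 1)) := by
    rw [← Complex.cpow_intCast, hM]
    push_cast
    rfl
  rw [hz] at hd
  -- The sign (-1)^j comes from differentiating s ↦ 1 - s and is its own inverse.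
  have hsq : ((-1 : ℂ) ^ j) * (-1) ^ j = 1 := by rw [← mul_pow]; simp
  rw [mul_assoc ((-1 : ℂ) ^ j)]
  simp only [← mul_assoc] at hd ⊢
  rw [mul_assoc ((-1 : ℂ) ^ j), ← hd, smul_eq_mul, ← mul_assoc, hsq, one_mul]

/-! ### From sums over tuples to Hurwitz zeta functions -/

lemma card_antidiagonalTuple {N : ℕ} (hN : 0 < N) (M : ℕ) :
    (Finset.Nat.antidiagonalTuple N M).card = (M + (N - 1)).choose (N - 1) := by
  have h := Finset.card_finsuppAntidiag_nat_eq_choose (s := (Finset.univ : Finset (Fin N))) M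
  rw [Finset.card_univ, Fintype.card_fin] at h
  have h2 : ((Finset.univ : Finset (Fin N)).finsuppAntidiag M).card =
      (Finset.Nat.antidiagonalTuple N M).card :=
    Finset.card_equiv Finsupp.equivFunOnFinite fun f => by
      rw [Finset.mem_finsuppAntidiag, Finset.Nat.mem_antidiagonalTuple]
      simp
  rw [← h2, h, show N + M - 1 = (N - 1) + M by omega, add_comm, Nat.choose_symm_add]

/-- Grouping a sum over tuples by their total. -/
lemma hasSum_comp_sum_fin {N : ℕ} (hN : 0 < N) {g : ℕ → ℂ} {S : ℂ}
    (h : HasSum (fun M => ((M + (N - 1)).choose (N - 1) : ℂ) * g M) S) :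
    HasSum (fun n : Fin N → ℕ => g (∑ i, n i)) S := by
  have hmem : ∀ M, ∀ n : Fin N → ℕ, n ∈ Finset.Nat.antidiagonalTuple N M ↔ ∑ i, n i = M :=
    fun M n => Finset.Nat.mem_antidiagonalTuple
  let inst : ∀ M, Fintype {n : Fin N → ℕ // ∑ i, n i = M} := fun M => Fintype.subtype _ (hmem M)
  have hcard : ∀ M, Fintype.card {n : Fin N → ℕ // ∑ i, n i = M} =
      (M + (N - 1)).choose (N - 1) := fun M => by
    rw [Fintype.subtype_card _ (hmem M), card_antidiagonalTuple hN]
  rw [← (Equiv.sigmaFiberEquiv fun n : Fin N → ℕ => ∑ i, n i).hasSum_iff]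
  have hval : ∀ p : (M : ℕ) × {n : Fin N → ℕ // ∑ i, n i = M},
      g (∑ i, (Equiv.sigmaFiberEquiv fun n : Fin N → ℕ => ∑ i, n i) p i) = g p.1 := by
    rintro ⟨M, n, hn⟩
    exact congrArg g hn
  simp only [Function.comp_def, hval]
  refine HasSum.sigma_of_hasSum h (fun M => ?_) ?_
  · convert hasSum_fintype (fun _ : {n : Fin N → ℕ // ∑ i, n i = M} => g M) using 1
    rw [Finset.sum_const, Finset.card_univ, hcard, nsmul_eq_mul]
  -- The norms on the fibre over M add up to the norm of the M-th term of `h`, and that series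
  -- converges absolutely.
  · refine Summable.of_norm ((summable_sigma_of_nonneg fun _ => norm_nonneg _).2
      ⟨fun M => (hasSum_fintype _).summable, ?_⟩)
    refine h.summable.norm.congr fun M => ?_
    simp only [tsum_fintype, Finset.sum_const, Finset.card_univ, hcard, nsmul_eq_mul, norm_mul,
      Complex.norm_natCast]

lemma natDegree_polyC_le (N : ℕ) : (polyC N).natDegree ≤ N - 1 := by
  refine (Polynomial.natDegree_prod_le _ _).trans ?_
  rw [Finset.sum_congr rfl fun i _ => Polynomial.natDegree_X_add_C ((i : ℕ) : ℂ)]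
  simp

/-- Taylor expansion of `C_{N,y}` at the origin. -/
lemma sum_derivC_mul_pow {N : ℕ} (hN : 0 < N) (y z : ℂ) :
    ∑ k ∈ Finset.range N, derivC N k y / (k ! : ℂ) * z ^ k = (polyC N).eval (z - y) := by
  set P := (polyC N).comp (Polynomial.X - Polynomial.C y) with hP
  have hdeg : P.natDegree < N := by
    refine lt_of_le_of_lt (Polynomial.natDegree_comp_le) ?_
    rw [Polynomial.natDegree_X_sub_C, mul_one]
    exact lt_of_le_of_lt (natDegree_polyC_le N) (by omega)
  have hev : (polyC N).eval (z - y) = P.eval z := by simp [hP]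
  rw [hev, Polynomial.eval_eq_sum_range' hdeg]
  refine Finset.sum_congr rfl fun k _ => ?_
  have hk : (k ! : ℂ) ≠ 0 := by exact_mod_cast k.factorial_ne_zero
  rw [derivC, ← hP, ← Polynomial.coeff_zero_eq_eval_zero, Polynomial.coeff_iterate_derivative,
    zero_add, Nat.descFactorial_self, nsmul_eq_mul, mul_div_cancel_left₀ _ hk]

/-- Lets C_N(M) / (N - 1)! count the N-tuples with sum M: the product (M + 1) ⋯ (M + N - 1) is a
rising factorial. -/
lemma eval_polyC_natCast (N M : ℕ) :
    (polyC N).eval (M : ℂ) = ((N - 1)! : ℂ) * ((M + (N - 1)).choose (N - 1) : ℂ) := by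
  have h := Nat.ascFactorial_eq_factorial_mul_choose M (N - 1)
  rw [Nat.ascFactorial_eq_prod_range] at h
  rw [polyC, Polynomial.eval_prod, ← Nat.cast_mul, ← h, ← Finset.Ico_add_one_right_eq_Icc,
    Finset.prod_Ico_eq_prod_range]
  push_cast
  simp [add_assoc]

/-- The Hurwitz zeta function with argument `Y + u / v`. -/
noncomputable def hurwitzShift (Y u v : ℕ) (s : ℂ) : ℂ :=
  hurwitz ((u : ℝ) / v) s - ∑ m ∈ Finset.range Y, (((m : ℝ) + (u : ℝ) / v : ℝ) : ℂ) ^ (-s)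

/-- Dropping the first Y terms of the series at u/v moves the argument to Y + u/v, while the
periodic function `hurwitz` is evaluated only on (0, 1]. -/
lemma hasSum_hurwitzShift {u v : ℕ} (hu : 1 ≤ u) (huv : u ≤ v) (Y : ℕ) {s : ℂ} (hs : 1 < s.re) :
    HasSum (fun n : ℕ => 1 / (((n : ℝ) + (Y + (u : ℝ) / v) : ℝ) : ℂ) ^ s) (hurwitzShift Y u v s) := by
  have hv : (0 : ℝ) < v := by exact_mod_cast (by omega : 0 < v)
  have hu' : (0 : ℝ) < u := by exact_mod_cast hu
  have hle : (u : ℝ) / v ≤ 1 := (div_le_one hv).2 (by exact_mod_cast huv)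
  have h := (hasSum_nat_add_iff' Y).2 (hasSum_hurwitz (div_pos hu' hv) hle hs)
  simp only [one_div, ← Complex.cpow_neg, hurwitzShift] at h ⊢
  refine h.congr_fun fun n => ?_
  push_cast
  rw [add_assoc]

/-- With t = M + y, the multiplicity C_N(t - y) / (N - 1)! is a polynomial in t, and each t^k ·
t^(-s) is a term of the Hurwitz series at s - k. -/
lemma hasSum_sum_hurwitzShift {N : ℕ} (hN : 0 < N) {u v : ℕ} (hu : 1 ≤ u) (huv : u ≤ v) (Y : ℕ)
    {s : ℂ} (hs : (N : ℝ) < s.re) :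
    HasSum (fun n : Fin N → ℕ =>
        1 / ((((∑ i, n i : ℕ) : ℝ) + (Y + (u : ℝ) / v) : ℝ) : ℂ) ^ s)
      (1 / ((N - 1)! : ℂ) * ∑ k ∈ Finset.range N,
        derivC N k ((Y + (u : ℝ) / v : ℝ) : ℂ) / (k ! : ℂ) * hurwitzShift Y u v (s - k)) := by
  refine hasSum_comp_sum_fin hN (g := fun M : ℕ => 1 / (((M : ℝ) + (Y + (u : ℝ) / v) : ℝ) : ℂ) ^ s) ?_
  have h : ∀ k ∈ Finset.range N, HasSum (fun M : ℕ =>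
      derivC N k ((Y + (u : ℝ) / v : ℝ) : ℂ) / (k ! : ℂ) *
        (1 / (((M : ℝ) + (Y + (u : ℝ) / v) : ℝ) : ℂ) ^ (s - k)))
      (derivC N k ((Y + (u : ℝ) / v : ℝ) : ℂ) / (k ! : ℂ) * hurwitzShift Y u v (s - k)) := by
    intro k hk
    refine (hasSum_hurwitzShift hu huv Y ?_).mul_left _
    -- Since k ≤ N - 1, the condition Re s > N leaves Re (s - k) > 1.
    have : (k : ℝ) + 1 ≤ N := by exact_mod_cast Finset.mem_range.1 hk
    simp
    linarith
  refine ((hasSum_sum h).mul_left _).congr_fun fun M => ?_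
  have hv : (0 : ℝ) < v := by exact_mod_cast (by omega : 0 < v)
  have hu' : (0 : ℝ) < u := by exact_mod_cast hu
  set y : ℝ := Y + (u : ℝ) / v with hy
  have hpos : 0 < (M : ℝ) + y := by positivity
  have hne : (((M : ℝ) + y : ℝ) : ℂ) ≠ 0 := by exact_mod_cast hpos.ne'
  have hT := sum_derivC_mul_pow hN (y : ℂ) (((M : ℝ) + y : ℝ) : ℂ)
  rw [show (((M : ℝ) + y : ℝ) : ℂ) - y = (M : ℂ) by push_cast; ring, eval_polyC_natCast] at hT
  have hfac : ((N - 1)! : ℂ) ≠ 0 := by exact_mod_cast (N - 1).factorial_ne_zero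
  have hsum : ∑ k ∈ Finset.range N, derivC N k (y : ℂ) / (k ! : ℂ) *
      (1 / (((M : ℝ) + y : ℝ) : ℂ) ^ (s - k)) =
      (∑ k ∈ Finset.range N, derivC N k (y : ℂ) / (k ! : ℂ) * (((M : ℝ) + y : ℝ) : ℂ) ^ k) *
        (1 / (((M : ℝ) + y : ℝ) : ℂ) ^ s) := by
    rw [Finset.sum_mul]
    refine Finset.sum_congr rfl fun k _ => ?_
    rw [Complex.cpow_sub _ _ hne, Complex.cpow_natCast, one_div_div]
    ring
  rw [hsum, hT]
  field_simp

lemma one_div_ofReal_mul_cpow {W z : ℝ} (hW : 0 < W) (hz : 0 < z) (s : ℂ) :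
    1 / ((W * z : ℝ) : ℂ) ^ s = (W : ℂ) ^ (-s) * (1 / (z : ℂ) ^ s) := by
  rw [Complex.ofReal_mul, Complex.mul_cpow_ofReal_nonneg hW.le hz.le, Complex.cpow_neg]
  simp [mul_comm]

/-- Splitting a sum over tuples into residue classes. -/
lemma hasSum_of_residues {N : ℕ} {ℓ : Fin N → ℕ} (hℓ : ∀ i, 0 < ℓ i) {f : (Fin N → ℕ) → ℂ}
    {S : (Fin N → ℕ) → ℂ}
    (h : ∀ κ ∈ Fintype.piFinset fun i => Finset.range (ℓ i),
      HasSum (fun m : Fin N → ℕ => f fun i => m i * ℓ i + κ i) (S κ)) :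
    HasSum f (∑ κ ∈ Fintype.piFinset fun i => Finset.range (ℓ i), S κ) := by
  have hne : ∀ i, NeZero (ℓ i) := fun i => ⟨(hℓ i).ne'⟩
  -- Coordinatewise division with remainder, with residues κ and quotients m.
  let e : ((_ : (i : Fin N) → Fin (ℓ i)) × (Fin N → ℕ)) ≃ (Fin N → ℕ) :=
    (Equiv.sigmaEquivProd _ _).trans ((Equiv.prodComm _ _).trans
      ((Equiv.arrowProdEquivProdArrow (Fin N) (fun _ => ℕ) (fun i => Fin (ℓ i))).symm.trans
        (Equiv.piCongrRight fun i => (Nat.divModEquiv (ℓ i)).symm)))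
  have he : ∀ p, e p = fun i => p.2 i * ℓ i + (p.1 i : ℕ) := fun p => rfl
  have h' : ∀ κ : (i : Fin N) → Fin (ℓ i),
      HasSum (fun m : Fin N → ℕ => f (e ⟨κ, m⟩)) (S fun i => κ i) := fun κ =>
    h (fun i => κ i) (Fintype.mem_piFinset.2 fun i => Finset.mem_range.2 (κ i).2)
  have hS : ∑ κ ∈ Fintype.piFinset fun i => Finset.range (ℓ i), S κ =
      ∑ κ : (i : Fin N) → Fin (ℓ i), S fun i => κ i := by
    refine (Finset.sum_bij (fun κ _ => fun i => (κ i : ℕ)) ?_ ?_ ?_ fun _ _ => rfl).symm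
    · exact fun κ _ => Fintype.mem_piFinset.2 fun i => Finset.mem_range.2 (κ i).2
    · exact fun κ _ κ' _ hk => funext fun i => Fin.ext (congrFun hk i)
    · exact fun κ hκ => ⟨fun i => ⟨κ i, Finset.mem_range.1 (Fintype.mem_piFinset.1 hκ i)⟩,
        Finset.mem_univ _, rfl⟩
  rw [hS, ← e.hasSum_iff]
  refine HasSum.sigma_of_hasSum (hasSum_fintype _) h' (Summable.of_norm
    ((summable_sigma_of_nonneg fun _ => norm_nonneg _).2
      ⟨fun κ => (h' κ).summable.norm, (hasSum_fintype _).summable⟩))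

/-! ### The explicit continuation and its uniqueness -/

section Continuation

variable {N : ℕ} (r q : Fin N → ℕ) (x : ℚ) (Y u v : (Fin N → ℕ) → ℕ)

/-- The Barnes zeta function as a combination of shifted Hurwitz zeta functions. -/
noncomputable def barnesContinuation (s : ℂ) : ℂ :=
  1 / ((N - 1)! : ℂ) * ((∑ κ ∈ periodBox r q, ∑ k ∈ Finset.range N,
    derivC N k (shiftedArg r q x κ : ℂ) / (k ! : ℂ) *
      hurwitzShift (Y κ) (u κ) (v κ) (s - k)) * ((commonPeriod r q : ℝ) : ℂ) ^ (-s))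

end Continuation

lemma commonPeriod_pos {N : ℕ} {r q : Fin N → ℕ} (hN : 0 < N) (hr : ∀ i, 0 < r i)
    (hq : ∀ i, 0 < q i) : 0 < commonPeriod r q := by
  refine div_pos ?_ ?_ <;> rw [Nat.cast_pos, Nat.pos_iff_ne_zero]
  · rw [Ne, Finset.lcm_eq_zero_iff]
    rintro ⟨i, _, hi⟩
    exact (hr i).ne' hi
  · rw [Ne, Finset.gcd_eq_zero_iff]
    exact fun h => (hq ⟨0, hN⟩).ne' (h _ (Finset.mem_univ _))

/-- The quotient is (lcm / r_i) · (q_i / gcd), a product of two integers, so the floor changes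
nothing. -/
lemma periodRatio_cast {N : ℕ} {r q : Fin N → ℕ} (hr : ∀ i, 0 < r i) (hq : ∀ i, 0 < q i)
    (i : Fin N) :
    (periodRatio r q i : ℚ) = commonPeriod r q / ((r i : ℚ) / (q i : ℚ)) := by
  obtain ⟨a, ha⟩ : r i ∣ Finset.univ.lcm r := Finset.dvd_lcm (Finset.mem_univ i)
  obtain ⟨b, hb⟩ : Finset.univ.gcd q ∣ q i := Finset.gcd_dvd (Finset.mem_univ i)
  have hr0 : (r i : ℚ) ≠ 0 := by exact_mod_cast (hr i).ne'
  have hq0 : (q i : ℚ) ≠ 0 := by exact_mod_cast (hq i).ne'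
  have hg0 : ((Finset.univ.gcd q : ℕ) : ℚ) ≠ 0 := by
    intro h
    rw [hb, Nat.cast_mul, h, zero_mul] at hq0
    exact hq0 rfl
  have h : commonPeriod r q / ((r i : ℚ) / (q i : ℚ)) = ((a * b : ℕ) : ℚ) := by
    rw [commonPeriod, ha, show (q i : ℚ) = (Finset.univ.gcd q : ℕ) * (b : ℚ) by exact_mod_cast hb]
    push_cast
    field_simp
  rw [periodRatio, h, Nat.floor_natCast]

lemma periodRatio_pos {N : ℕ} {r q : Fin N → ℕ} (hN : 0 < N) (hr : ∀ i, 0 < r i)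
    (hq : ∀ i, 0 < q i) (i : Fin N) : 0 < periodRatio r q i := by
  have h := periodRatio_cast hr hq i
  have h1 : (0 : ℚ) < r i := by exact_mod_cast hr i
  have h2 : (0 : ℚ) < q i := by exact_mod_cast hq i
  have h3 : (0 : ℚ) < periodRatio r q i := by
    rw [h]
    exact div_pos (commonPeriod_pos hN hr hq) (div_pos h1 h2)
  exact_mod_cast h3

lemma differentiableAt_hurwitzShift {u v : ℕ} (hu : 1 ≤ u) (huv : u ≤ v) (Y : ℕ) {s : ℂ}
    (hs : s ≠ 1) : DifferentiableAt ℂ (hurwitzShift Y u v) s := by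
  have hv : (0 : ℝ) < v := by exact_mod_cast (by omega : 0 < v)
  have hu' : (0 : ℝ) < u := by exact_mod_cast hu
  exact (differentiableAt_hurwitz _ hs).sub (DifferentiableAt.fun_sum fun m _ =>
    (analyticAt_const_cpow_neg (by positivity) s).differentiableAt)

lemma meromorphicAt_hurwitz_sub (y : ℝ) (k s : ℂ) :
    MeromorphicAt (fun s => hurwitz y (s - k)) s := by
  have hlin : AnalyticAt ℂ (fun s : ℂ => s - k) s := analyticAt_id.sub analyticAt_const
  have h : MeromorphicAt (fun s => hurwitzRegular y (s - k) + 1 / (s - k - 1)) s :=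
    ((AnalyticAt.fun_comp ((differentiable_hurwitzRegular y).analyticAt _) hlin).meromorphicAt).add
      ((MeromorphicAt.const 1 s).div (hlin.sub analyticAt_const).meromorphicAt)
  refine h.congr ?_
  have hne : ∀ᶠ z : ℂ in 𝓝[≠] s, z ≠ k + 1 := by
    rcases eq_or_ne s (k + 1) with h | h
    · rw [h]
      exact self_mem_nhdsWithin
    · exact nhdsWithin_le_nhds (isOpen_compl_singleton.mem_nhds h)
  filter_upwards [hne] with z hz
  rw [hurwitz_eq_hurwitzRegular]
  exact fun h => hz (by linear_combination h)

/-- On the residue class of κ, the relation ℓ_i w_i = w gives x + ∑ (m_i ℓ_i + κ_i) w_i = w (∑ m_i +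
y(κ)), so the class contributes w^(-s) times a series in ∑ m_i. -/
lemma isBarnesZeta_barnesContinuation {N : ℕ} (hN : 0 < N) {r q : Fin N → ℕ}
    (hr : ∀ i, 0 < r i) (hq : ∀ i, 0 < q i) {x : ℚ} {Y u v : (Fin N → ℕ) → ℕ}
    (huv : ∀ κ ∈ periodBox r q, 1 ≤ u κ ∧ u κ ≤ v κ)
    (hY : ∀ κ ∈ periodBox r q,
      shiftedArg r q x κ = (Y κ : ℚ) + (u κ : ℚ) / (v κ : ℚ)) :
    IsBarnesZeta N (x : ℂ) (fun i => (r i : ℂ) / (q i : ℂ)) (barnesContinuation r q x Y u v) := by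
  have hWq := commonPeriod_pos hN hr hq
  have hW : (0 : ℝ) < (commonPeriod r q : ℝ) := by exact_mod_cast hWq
  refine ⟨fun s hs => ?_, fun s => ?_, fun s hs => ?_⟩
  · have e : barnesContinuation r q x Y u v s = ∑ κ ∈ periodBox r q,
        ((commonPeriod r q : ℝ) : ℂ) ^ (-s) * (1 / ((N - 1)! : ℂ) * ∑ k ∈ Finset.range N,
          derivC N k ((Y κ + (u κ : ℝ) / v κ : ℝ) : ℂ) / (k ! : ℂ) *
            hurwitzShift (Y κ) (u κ) (v κ) (s - k)) := by
      rw [barnesContinuation, Finset.sum_mul, Finset.mul_sum]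
      refine Finset.sum_congr rfl fun κ hκ => ?_
      have hc : (shiftedArg r q x κ : ℂ) = ((Y κ + (u κ : ℝ) / v κ : ℝ) : ℂ) := by
        rw [hY κ hκ]
        push_cast
        rfl
      rw [hc]
      ring
    rw [e]
    refine hasSum_of_residues (periodRatio_pos hN hr hq) fun κ hκ => ?_
    obtain ⟨hu, hv⟩ := huv κ hκ
    refine ((hasSum_sum_hurwitzShift hN hu hv (Y κ) hs).mul_left _).congr_fun fun m => ?_
    have hv0 : (0 : ℝ) < v κ := by exact_mod_cast (by omega : 0 < v κ)
    have hu0 : (0 : ℝ) < u κ := by exact_mod_cast hu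
    rw [← one_div_ofReal_mul_cpow hW (by positivity)]
    congr 2
    have hq1 : x + ∑ i, ((m i * periodRatio r q i + κ i : ℕ) : ℚ) * ((r i : ℚ) / q i) =
        commonPeriod r q * ((∑ i, m i : ℕ) + (Y κ + (u κ : ℚ) / v κ)) := by
      rw [← hY κ hκ, shiftedArg, mul_add, ← mul_assoc, mul_inv_cancel₀ hWq.ne', one_mul]
      have : ∀ i, ((m i * periodRatio r q i + κ i : ℕ) : ℚ) * ((r i : ℚ) / q i) =
          commonPeriod r q * m i + κ i * ((r i : ℚ) / q i) := by
        intro i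
        have h1 : ((r i : ℚ) / q i) ≠ 0 :=
          div_ne_zero (by exact_mod_cast (hr i).ne') (by exact_mod_cast (hq i).ne')
        rw [Nat.cast_add, Nat.cast_mul, periodRatio_cast hr hq, add_mul, mul_assoc,
          div_mul_cancel₀ _ h1, mul_comm (m i : ℚ)]
      simp only [this]
      rw [Finset.sum_add_distrib, ← Finset.mul_sum, Nat.cast_sum]
      ring
    have hq2 := congrArg (fun t : ℚ => (t : ℂ)) hq1
    push_cast at hq2 ⊢
    exact hq2
  · refine (MeromorphicAt.const _ s).mul (MeromorphicAt.mul ?_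
      (analyticAt_const_cpow_neg hW s).meromorphicAt)
    refine MeromorphicAt.fun_sum fun κ hκ => MeromorphicAt.fun_sum fun k _ =>
      (MeromorphicAt.const _ s).mul ?_
    obtain ⟨hu, hv⟩ := huv κ hκ
    have hv0 : (0 : ℝ) < v κ := by exact_mod_cast (by omega : 0 < v κ)
    have hu0 : (0 : ℝ) < u κ := by exact_mod_cast hu
    refine (meromorphicAt_hurwitz_sub _ _ s).sub (AnalyticAt.meromorphicAt ?_)
    refine Finset.analyticAt_fun_sum _ fun m _ => ?_
    have hlin : AnalyticAt ℂ (fun s : ℂ => s - k) s := analyticAt_id.sub analyticAt_const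
    exact AnalyticAt.fun_comp (g := fun s : ℂ => (((m : ℝ) + (u κ : ℝ) / v κ : ℝ) : ℂ) ^ (-s))
      (analyticAt_const_cpow_neg (by positivity) (s - k)) hlin
  · refine DifferentiableAt.differentiableWithinAt ?_
    refine (differentiableAt_const _).mul (DifferentiableAt.mul ?_
      (analyticAt_const_cpow_neg hW s).differentiableAt)
    refine DifferentiableAt.fun_sum fun κ hκ => DifferentiableAt.fun_sum fun k hk =>
      (differentiableAt_const _).mul ?_
    obtain ⟨hu, hv⟩ := huv κ hκ
    -- The k-th summand can be singular only at s = k + 1, and k < N places this point in {1, …, N}.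
    have h1 : s - k ≠ 1 := fun h => hs ⟨k + 1, by
      have := Finset.mem_range.1 hk
      rw [Finset.mem_Icc]
      omega, by
      push_cast
      linear_combination h⟩
    exact DifferentiableAt.fun_comp' s (differentiableAt_hurwitzShift hu hv (Y κ) h1)
      (differentiableAt_id.sub_const _)

/-- The Barnes zeta function is determined outside `{1, …, N}`. -/
lemma IsBarnesZeta.eqOn {N : ℕ} {x : ℂ} {w : Fin N → ℂ} {Z Z' : ℂ → ℂ}
    (h : IsBarnesZeta N x w Z) (h' : IsBarnesZeta N x w Z') :
    Set.EqOn Z Z' {s : ℂ | ∃ k ∈ Finset.Icc 1 N, s = (k : ℂ)}ᶜ := by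
  set A : Set ℂ := {s : ℂ | ∃ k ∈ Finset.Icc 1 N, s = (k : ℂ)}
  have hfin : A.Finite := by
    refine ((Finset.Icc 1 N).image fun k : ℕ => (k : ℂ)).finite_toSet.subset ?_
    rintro s ⟨k, hk, rfl⟩
    exact Finset.mem_coe.2 (Finset.mem_image_of_mem _ hk)
  have hopen : IsOpen Aᶜ := hfin.isClosed.isOpen_compl
  -- Removing countably many points from a real plane leaves it path connected, so agreement near N
  -- + 1, where the series converges, spreads everywhere.
  have hconn : IsPreconnected Aᶜ :=
    (hfin.countable.isPathConnected_compl_of_one_lt_rank (by simp)).isConnected.isPreconnected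
  have hU : {s : ℂ | (N : ℝ) < s.re} ∈ 𝓝 ((N : ℂ) + 1) :=
    (isOpen_lt continuous_const Complex.continuous_re).mem_nhds (by simp)
  refine (h.holomorphic.analyticOnNhd hopen).eqOn_of_preconnected_of_eventuallyEq
    (h'.holomorphic.analyticOnNhd hopen) hconn (z₀ := (N : ℂ) + 1) ?_ ?_
  · rintro ⟨k, hk, hk'⟩
    have : N + 1 = k := by exact_mod_cast hk'
    have := (Finset.mem_Icc.1 hk).2
    omega
  · filter_upwards [hU] with s hs using (h.hasSum s hs).unique (h'.hasSum s hs)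

/-- The half-plane Re s < 1 avoids {1, …, N}. Agreement on a neighbourhood, not just at -l, is what
transfers derivatives. -/
lemma IsBarnesZeta.eventuallyEq {N : ℕ} {x : ℂ} {w : Fin N → ℂ} {Z Z' : ℂ → ℂ}
    (h : IsBarnesZeta N x w Z) (h' : IsBarnesZeta N x w Z') (l : ℕ) : Z =ᶠ[𝓝 (-(l : ℂ))] Z' := by
  have hU : {s : ℂ | s.re < 1} ∈ 𝓝 (-(l : ℂ)) := by
    refine (isOpen_lt Complex.continuous_re continuous_const).mem_nhds ?_
    have : (0 : ℝ) ≤ l := l.cast_nonneg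
    simp
    linarith
  filter_upwards [hU] with s hs
  refine h.eqOn h' ?_
  rintro ⟨k, hk, rfl⟩
  have h1 : ((k : ℕ) : ℝ) < 1 := by simpa using hs
  have h2 : k < 1 := by exact_mod_cast h1
  have := (Finset.mem_Icc.1 hk).1
  omega

lemma iteratedDeriv_hurwitzShift_neg {u v : ℕ} (hu : 1 ≤ u) (huv : u ≤ v) (Y j p : ℕ) :
    iteratedDeriv j (hurwitzShift Y u v) (-(p : ℂ)) =
      iteratedDeriv j (hurwitz ((u : ℝ) / v)) (-(p : ℂ)) -
        ∑ m ∈ Finset.range Y, (-(Real.log ((m : ℝ) + (u : ℝ) / v) : ℂ)) ^ j *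
          ((m : ℂ) + (u : ℂ) / v) ^ p := by
  have hv : (0 : ℝ) < v := by exact_mod_cast (by omega : 0 < v)
  have hu' : (0 : ℝ) < u := by exact_mod_cast hu
  have hp1 : -(p : ℂ) ≠ 1 := fun h => by
    have := congrArg Complex.re h
    have h1 : (0 : ℝ) ≤ p := p.cast_nonneg
    simp at this
    linarith
  have hc : ∀ m : ℕ, AnalyticAt ℂ (fun s : ℂ => (((m : ℝ) + (u : ℝ) / v : ℝ) : ℂ) ^ (-s)) (-(p : ℂ)) :=
    fun m => analyticAt_const_cpow_neg (by positivity) _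
  have e : hurwitzShift Y u v = fun s => hurwitz ((u : ℝ) / v) s -
    ∑ m ∈ Finset.range Y, (((m : ℝ) + (u : ℝ) / v : ℝ) : ℂ) ^ (-s) := rfl
  rw [e, iteratedDeriv_fun_sub ((analyticAt_hurwitz _ hp1).contDiffAt.of_le le_top)
    (ContDiffAt.sum fun m _ => (hc m).contDiffAt.of_le le_top),
    iteratedDeriv_fun_sum fun m _ => (hc m).contDiffAt.of_le le_top]
  congr 1
  refine Finset.sum_congr rfl fun m _ => ?_
  rw [iteratedDeriv_const_cpow_neg (by positivity), neg_neg, Complex.cpow_natCast]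
  push_cast
  rfl

lemma iteratedDeriv_barnesContinuation_neg {N : ℕ} (hN : 0 < N) {r q : Fin N → ℕ}
    (hr : ∀ i, 0 < r i) (hq : ∀ i, 0 < q i) (x : ℚ) {Y u v : (Fin N → ℕ) → ℕ}
    (huv : ∀ κ ∈ periodBox r q, 1 ≤ u κ ∧ u κ ≤ v κ) (l n : ℕ) :
    iteratedDeriv n (barnesContinuation r q x Y u v) (-(l : ℂ)) =
      1 / ((N - 1)! : ℂ) *
        ∑ j ∈ Finset.range (n + 1), (n.choose j : ℂ) *
          (-(Real.log (commonPeriod r q : ℝ) : ℂ)) ^ (n - j) * (commonPeriod r q : ℂ) ^ l *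
          ∑ κ ∈ periodBox r q, ∑ k ∈ Finset.range N,
            derivC N k (shiftedArg r q x κ : ℂ) / (k ! : ℂ) *
              iteratedDeriv j (hurwitzShift (Y κ) (u κ) (v κ)) (-((l + k : ℕ) : ℂ)) := by
  have hW : (0 : ℝ) < (commonPeriod r q : ℝ) := by exact_mod_cast commonPeriod_pos hN hr hq
  have hne : ∀ k : ℕ, ∀ᶠ s : ℂ in 𝓝 (-(l : ℂ)), s - k ≠ 1 := fun k => by
    refine (isOpen_ne_fun (by fun_prop) continuous_const).mem_nhds fun h => ?_
    have := congrArg Complex.re h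
    have h1 : (0 : ℝ) ≤ l := l.cast_nonneg
    have h2 : (0 : ℝ) ≤ k := k.cast_nonneg
    simp at this
    linarith
  have han : ∀ κ ∈ periodBox r q, ∀ k ∈ Finset.range N, AnalyticAt ℂ (fun s : ℂ =>
      derivC N k (shiftedArg r q x κ : ℂ) / (k ! : ℂ) *
        hurwitzShift (Y κ) (u κ) (v κ) (s - k)) (-(l : ℂ)) := by
    intro κ hκ k _
    obtain ⟨hu, hv⟩ := huv κ hκ
    refine analyticAt_const.mul ?_
    rw [Complex.analyticAt_iff_eventually_differentiableAt]
    filter_upwards [hne k] with s hs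
    exact DifferentiableAt.fun_comp' s (differentiableAt_hurwitzShift hu hv (Y κ) hs)
      (differentiableAt_id.sub_const _)
  have e : barnesContinuation r q x Y u v = fun s => 1 / ((N - 1)! : ℂ) *
    ((∑ κ ∈ periodBox r q, ∑ k ∈ Finset.range N,
      derivC N k (shiftedArg r q x κ : ℂ) / (k ! : ℂ) *
        hurwitzShift (Y κ) (u κ) (v κ) (s - k)) * ((commonPeriod r q : ℝ) : ℂ) ^ (-s)) := rfl
  rw [e, iteratedDeriv_const_mul_field, iteratedDeriv_fun_mul
    (ContDiffAt.sum fun κ hκ => ContDiffAt.sum fun k hk =>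
      (han κ hκ k hk).contDiffAt.of_le le_top)
    ((analyticAt_const_cpow_neg hW _).contDiffAt.of_le le_top)]
  congr 1
  refine Finset.sum_congr rfl fun j _ => ?_
  rw [iteratedDeriv_const_cpow_neg hW, neg_neg, Complex.cpow_natCast, Complex.ofReal_ratCast,
    iteratedDeriv_fun_sum fun κ hκ => ContDiffAt.sum fun k hk =>
      (han κ hκ k hk).contDiffAt.of_le le_top]
  have hin : ∀ κ ∈ periodBox r q, iteratedDeriv j (fun s : ℂ => ∑ k ∈ Finset.range N,
      derivC N k (shiftedArg r q x κ : ℂ) / (k ! : ℂ) *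
        hurwitzShift (Y κ) (u κ) (v κ) (s - k)) (-(l : ℂ)) = ∑ k ∈ Finset.range N,
      derivC N k (shiftedArg r q x κ : ℂ) / (k ! : ℂ) *
        iteratedDeriv j (hurwitzShift (Y κ) (u κ) (v κ)) (-((l + k : ℕ) : ℂ)) := by
    intro κ hκ
    rw [iteratedDeriv_fun_sum fun k hk => (han κ hκ k hk).contDiffAt.of_le le_top]
    refine Finset.sum_congr rfl fun k _ => ?_
    rw [iteratedDeriv_const_mul_field, iteratedDeriv_comp_sub_const]
    congr 2
    push_cast
    ring_nf
  rw [Finset.sum_congr rfl hin]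
  ring

/-! ### The main theorem -/

theorem mainTheorem7
    (N : ℕ) (hN : 0 < N)
    (r q : Fin N → ℕ) (hr : ∀ i, 0 < r i) (hq : ∀ i, 0 < q i)
    (hrq : ∀ i, Nat.gcd (r i) (q i) = 1)
    (x : ℚ) (hx : 0 < x) (l n : ℕ)
    (Y u v : (Fin N → ℕ) → ℕ)
    (huv : ∀ κ ∈ periodBox r q, 1 ≤ u κ ∧ u κ ≤ v κ)
    (hY : ∀ κ ∈ periodBox r q,
      shiftedArg r q x κ = (Y κ : ℚ) + (u κ : ℚ) / (v κ : ℚ)) :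
    -- the numbers `w / w_i` are integers
    (∀ i, (periodRatio r q i : ℚ) = commonPeriod r q / ((r i : ℚ) / (q i : ℚ))) ∧
    -- the Barnes zeta function has its meromorphic continuation
    IsBarnesZeta N (x : ℂ) (fun i => (r i : ℂ) / (q i : ℂ))
      (barnesZeta N (x : ℂ) (fun i => (r i : ℂ) / (q i : ℂ))) ∧
    -- the formula for the `n`-th derivative at `-l`
    iteratedDeriv n (barnesZeta N (x : ℂ) (fun i => (r i : ℂ) / (q i : ℂ))) (-(l : ℂ)) =
      1 / ((N - 1)! : ℂ) *
        ∑ j ∈ Finset.range (n + 1), (n.choose j : ℂ) *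
          (-(Real.log (commonPeriod r q : ℝ) : ℂ)) ^ (n - j) * (commonPeriod r q : ℂ) ^ l *
          ∑ κ ∈ periodBox r q, ∑ k ∈ Finset.range N,
            derivC N k (shiftedArg r q x κ : ℂ) / (k ! : ℂ) *
            ((-1) ^ j * 2 *
                (∑ t ∈ Finset.Nat.antidiagonalTuple 3 j,
                  (j ! : ℂ) / ((t 0)! * (t 1)! * (t 2)!) *
                    iteratedDeriv (t 0) Complex.Gamma ((l : ℂ) + k + 1) *
                    (-(Real.log (2 * Real.pi * v κ) : ℂ)) ^ (t 1) *
                    (2 * Real.pi * v κ : ℂ) ^ (-((l : ℤ) + k + 1)) *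
                    iteratedDeriv (t 2) (hurwitzH (u κ) (v κ)) ((l : ℂ) + k + 1)) -
              ∑ m ∈ Finset.range (Y κ),
                (-(Real.log ((m : ℝ) + (u κ : ℝ) / (v κ : ℝ)) : ℂ)) ^ j *
                  ((m : ℂ) + (u κ : ℂ) / (v κ : ℂ)) ^ (l + k)) ∧
    -- `H(s, u/v)` is entire; its derivatives at positive integers
    (∀ U V : ℕ, 1 ≤ U → U ≤ V →
      Differentiable ℂ (hurwitzH U V) ∧
      (∀ c m : ℕ, 2 ≤ m →
        iteratedDeriv c (hurwitzH U V) (m : ℂ) =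
          -∑ k ∈ Finset.Icc 1 V, ∑ i ∈ Finset.range (c + 1),
            (c.choose i : ℂ) * ((Real.pi : ℂ) / 2) ^ (c - i) *
              (Real.sin (Real.pi * ((m : ℝ) + c - i - 1) / 2 -
                2 * Real.pi * k * ((U : ℝ) / V)) : ℂ) *
              iteratedDeriv i (hurwitz ((k : ℝ) / V)) (m : ℂ)) ∧
      (∀ i m k : ℕ, 2 ≤ m → k ∈ Finset.Icc 1 V →
        HasSum (fun h : ℕ =>
            (((-Real.log ((h : ℝ) + (k : ℝ) / V)) ^ i *
              ((h : ℝ) + (k : ℝ) / V) ^ (-(m : ℤ)) : ℝ) : ℂ))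
          (iteratedDeriv i (hurwitz ((k : ℝ) / V)) (m : ℂ))) ∧
      (∀ c : ℕ,
        iteratedDeriv c (hurwitzH U V) 1 =
          epsilonTerm c U V +
            ∑ k ∈ Finset.Icc 1 V, ∑ i ∈ Finset.range (c + 1),
              (-1) ^ (i + 1) * (c.choose i : ℂ) * ((Real.pi : ℂ) / 2) ^ (c - i) *
                (Real.sin (Real.pi * ((c : ℝ) - i) / 2 -
                  2 * Real.pi * k * ((U : ℝ) / V)) : ℂ) *
                stieltjes i ((k : ℝ) / V))) ∧
    -- the derivatives of `Γ` at positive integers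
    (∀ a m : ℕ, 1 ≤ m →
      iteratedDeriv a Complex.Gamma (m : ℂ) =
        ((m - 1)! : ℂ) * ∑ k ∈ partitionTuples a,
          (a ! : ℂ) / (∏ i, ((k i)! : ℂ)) *
            ∏ i : Fin a,
              (iteratedDeriv (i : ℕ) Complex.digamma (m : ℂ) / (((i : ℕ) + 1)! : ℂ)) ^ (k i)) ∧
    -- the derivatives of `ψ = Γ' / Γ` at positive integers
    (∀ m : ℕ, 1 ≤ m →
      Complex.digamma (m : ℂ) =
        -(Real.eulerMascheroniConstant : ℂ) + ∑ k ∈ Finset.Icc 1 (m - 1), 1 / (k : ℂ)) ∧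
    (∀ b m : ℕ, 1 ≤ b → 1 ≤ m →
      iteratedDeriv b Complex.digamma (m : ℂ) =
        (-1) ^ (b + 1) * (b ! : ℂ) *
          (riemannZeta ((b : ℂ) + 1) - ∑ k ∈ Finset.Icc 1 (m - 1), 1 / (k : ℂ) ^ (b + 1))) := by
  refine ⟨periodRatio_cast hr hq, ?_, ?_, fun U V hU hUV => ⟨differentiable_hurwitzH hU hUV,
    fun c m hm => iteratedDeriv_hurwitzH_of_two_le U V c hm, fun i m k hm hk => ?_,
    fun c => iteratedDeriv_hurwitzH_one hU hUV c⟩,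
    fun a m hm => iteratedDeriv_Gamma_natCast a hm, fun m hm => digamma_natCast hm,
    fun b m hb hm => iteratedDeriv_digamma_natCast hb hm⟩
  -- The explicit continuation proves existence, so the chosen function has the defining properties
  -- too.
  · exact Classical.epsilon_spec ⟨_, isBarnesZeta_barnesContinuation hN hr hq huv hY⟩
  · have hZ := isBarnesZeta_barnesContinuation hN hr hq huv hY
    have hB : IsBarnesZeta N (x : ℂ) (fun i => (r i : ℂ) / (q i : ℂ))
        (barnesZeta N (x : ℂ) (fun i => (r i : ℂ) / (q i : ℂ))) := Classical.epsilon_spec ⟨_, hZ⟩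
    -- The chosen function may differ from the explicit one on {1, …, N}, but their germs at -l
    -- coincide.
    rw [(hB.eventuallyEq hZ l).iteratedDeriv_eq,
      iteratedDeriv_barnesContinuation_neg hN hr hq x huv]
    congr 1
    refine Finset.sum_congr rfl fun j _ => ?_
    congr 1
    refine Finset.sum_congr rfl fun κ hκ => Finset.sum_congr rfl fun k _ => ?_
    obtain ⟨hu, hv⟩ := huv κ hκ
    rw [iteratedDeriv_hurwitzShift_neg hu hv, iteratedDeriv_hurwitz_neg hu hv]
    push_cast
    rfl
  · obtain ⟨hk1, hkV⟩ := Finset.mem_Icc.1 hk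
    have hV : (0 : ℝ) < V := by exact_mod_cast (by omega : 0 < V)
    have hk' : (0 : ℝ) < k := by exact_mod_cast hk1
    exact hasSum_iteratedDeriv_hurwitz_natCast (div_pos hk' hV)
      ((div_le_one hV).2 (by exact_mod_cast hkV)) i hm
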